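/- Rooted trees are finite and are considered up to isomorphism; let $\mathbb{T}$ be the set of all of them, and let $|t|$ be the number of vertices of $t\in\mathbb{T}$. For $s,t\in\mathbb{T}$ and a vertex $v$ of $s$, let $s\cup_v t$ be the rooted tree obtained by joining the root of $t$ to $v$ by a new edge (its root is the root of $s$). Removing an edge $e$ of $t$ leaves two rooted trees: $R_e(t)$, which contains the root of $t$, and $P_e(t)$, whose root is the end of $e$ farther from the root of $t$. For $t_1,t_2,t_3\in\mathbb{T}$ put $$\alpha(t_1,t_2,t_3)=|\{e\in E(t_2)\mid R_e(t_2)=t_3,\ P_e(t_2)=t_1\}|,\qquad \beta(t_1,t_2,t_3)=|\{v\in V(t_3)\mid t_1=t_3\cup_v t_2\}|.$$ The insertion-elimination Lie algebra $\mathfrak{g}$ is the Lie algebra over $\mathbb{C}$ with basis $\{d\}\cup\{D_t^+,D_t^-\mid t\in\mathbb{T}\}$ and brackets, for $s,t\in\mathbb{T}$, \begin{align*} [D_s^+,D_t^+]&=\sum_{r\in\mathbb{T}}\bigl(\beta(r,s,t)-\beta(r,t,s)\bigr)D_r^+,\\ [D_s^-,D_t^-]&=\sum_{r\in\mathbb{T}}\bigl(\alpha(t,r,s)-\alpha(s,r,t)\bigr)D_r^-,\\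 [D_s^-,D_t^+]&=\sum_{r\in\mathbb{T}}\alpha(s,t,r)D_r^+ +\sum_{r\in\mathbb{T}}\beta(s,t,r)D_r^- +\delta_{s,t}\,d,\\ [d,D_t^-]&=-|t|D_t^-,\qquad [d,D_t^+]=|t|D_t^+ . \end{align*} Let $\mathfrak{h}=\mathbb{C}d$ and $\mathfrak{n}^+=\operatorname{span}\{D_t^+\mid t\in\mathbb{T}\}$. For $\mu\in\mathfrak{h}^*$ let $M(\mu)=U(\mathfrak{g})\otimes_{U(\mathfrak{h}\oplus\mathfrak{n}^+)}\mathbb{C}_\mu$ be the Verma module, where $\mathbb{C}_\mu$ is the one-dimensional $(\mathfrak{h}\oplus\mathfrak{n}^+)$-module on which $h+n$ ($h\in\mathfrak{h}$, $n\in\mathfrak{n}^+$) acts by $\mu(h)$. Let $Z(\mathfrak{g})$ be the center of $U(\mathfrak{g})$; a $\mathfrak{g}$-module $V$ admits the central character $\chi:Z(\mathfrak{g})\to\mathbb{C}$ (an algebra homomorphism) if $zv=\chi(z)v$ for all $z\in Z(\mathfrak{g})$ and $v\in V$. Corollary. All Verma modules of the insertion-elimination Lie algebra $\mathfrak{g}$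 admit the same central character: there is a central character $\chi:Z(\mathfrak{g})\to\mathbb{C}$ such that, for every $\mu\in\mathfrak{h}^*$, the Verma module $M(\mu)$ admits $\chi$. -/

import Mathlib

namespace InsElim

/-! ### Rooted trees -/

/-- Finite rooted trees, in the sense of Mathlib's `RootedTree`: the vertices carry the ancestor
order, in which `v ≤ w` means that `v` lies on the path from the root `⊥` to `w`. -/
structure FinTree extends RootedTree.{0} where
  finite : Finite α

/-- The vertices `V(t)` of a finite rooted tree. -/
instance : CoeSort FinTree Type := ⟨fun t => t.toRootedTree.α⟩

instance (t : FinTree) : Finite t := t.finite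

/-- Isomorphism of finite rooted trees. -/
instance FinTree.setoid : Setoid FinTree where
  r s t := Nonempty (s ≃o t)
  iseqv := ⟨fun _ => ⟨OrderIso.refl _⟩, fun ⟨e⟩ => ⟨e.symm⟩, fun ⟨e⟩ ⟨f⟩ => ⟨e.trans f⟩⟩

/-- The set `𝕋` of all (finite) rooted trees, up to isomorphism. -/
abbrev Tree : Type 1 := Quotient FinTree.setoid

/-- A rooted tree representing the isomorphism class. -/
noncomputable def Tree.rep (t : Tree) : FinTree := Quotient.out t

/-- The number `|t|` of vertices. -/
noncomputable def Tree.order (t : Tree) : ℕ := Nat.card t.rep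

/-- The vertices of `V ∪_v S`: those of `V` together with those of `S`. -/
inductive Graft (V : Type) (v : V) (S : Type) : Type
  | inl (a : V) : Graft V v S
  | inr (b : S) : Graft V v S

/-- The ancestor order of `V ∪_v S`, the tree obtained by joining the root of `S` to the vertex `v`
of `V` by a new edge: a vertex `a` of `V` is an ancestor of the vertices of `S` iff it is an ancestor
of `v`, and within `V` and `S` nothing changes. -/
instance (V : Type) [PartialOrder V] (v : V) (S : Type) [PartialOrder S] :
    PartialOrder (Graft V v S) where
  le
    | .inl a, .inl b => a ≤ b
    | .inl a, .inr _ => a ≤ v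
    | .inr _, .inl _ => False
    | .inr a, .inr b => a ≤ b
  le_refl
    | .inl a => le_refl a
    | .inr a => le_refl a
  le_trans
    | .inl _, .inl _, .inl _, h, h' => le_trans (α := V) h h'
    | .inl _, .inl _, .inr _, h, h' => le_trans (α := V) h h'
    | .inl _, .inr _, .inr _, h, _ => h
    | .inr _, .inr _, .inr _, h, h' => le_trans (α := S) h h'
  le_antisymm
    | .inl _, .inl _, h, h' => congrArg Graft.inl (le_antisymm (α := V) h h')
    | .inr _, .inr _, h, h' => congrArg Graft.inr (le_antisymm (α := S) h h')

/-- `β(t₁, t₂, t₃)` is the number of vertices `v` of `t₃` with `t₁ = t₃ ∪_v t₂`. -/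
noncomputable def β (t₁ t₂ t₃ : Tree) : ℕ :=
  Nat.card {v : t₃.rep // Nonempty (t₁.rep ≃o Graft t₃.rep v t₂.rep)}

/-- `α(t₁, t₂, t₃)` is the number of edges `e` of `t₂` with `R_e(t₂) = t₃` and `P_e(t₂) = t₁`. An
edge is given by its lower end `v ≠ ⊥`; removing it leaves the branch subtree `P_e(t₂)`, whose
vertices are the descendants of `v` (`v` included), and the root subtree `R_e(t₂)`, formed by all
the other vertices. -/
noncomputable def α (t₁ t₂ t₃ : Tree) : ℕ :=
  Nat.card {v : t₂.rep // v ≠ ⊥ ∧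
    Nonempty ({w : t₂.rep // ¬ v ≤ w} ≃o t₃.rep) ∧ Nonempty ({w : t₂.rep // v ≤ w} ≃o t₁.rep)}

/-! ### The combinatorics behind the Jacobi identity -/

/-- A partial order is the ancestor order of a rooted tree. -/
def IsTreeOrder (V : Type) [PartialOrder V] : Prop :=
  (∃ r : V, IsBot r) ∧ ∀ a b v : V, a ≤ v → b ≤ v → a ≤ b ∨ b ≤ a

theorem exists_greatest {V : Type} [PartialOrder V] [Finite V] (s : Set V) (hs : s.Nonempty)
    (h : ∀ a ∈ s, ∀ b ∈ s, a ≤ b ∨ b ≤ a) : ∃ m, IsGreatest s m := by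
  obtain ⟨m, hm⟩ := (Set.toFinite s).exists_maximal hs
  refine ⟨m, hm.1, fun c hc => ?_⟩
  rcases h c hc m hm.1 with h1 | h1
  · exact h1
  · exact hm.2 hc h1

theorem FinTree.isTreeOrder (t : FinTree) : IsTreeOrder t :=
  ⟨⟨⊥, isBot_bot⟩, fun _ _ _ h h' => (le_total_of_directed h h').symm⟩

open Classical in
/-- The rooted tree with a given ancestor order. -/
noncomputable def toFinTree (V : Type) [PartialOrder V] [Finite V] (h : IsTreeOrder V) : FinTree :=
  have hinf : ∀ a b : V, ∃ m, IsGreatest {c | c ≤ a ∧ c ≤ b} m := fun a b =>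
    exists_greatest _ ⟨h.1.choose, h.1.choose_spec a, h.1.choose_spec b⟩
      fun x hx y hy => h.2 x y a hx.1 hy.1
  have hpred : ∀ a : V, (∃ c, c < a) → ∃ m, IsGreatest {c | c < a} m := fun a ha =>
    exists_greatest _ ha fun x hx y hy => h.2 x y a (le_of_lt hx) (le_of_lt hy)
  letI : SemilatticeInf V :=
    { inf := fun a b => (hinf a b).choose
      inf_le_left := fun a b => (hinf a b).choose_spec.1.1
      inf_le_right := fun a b => (hinf a b).choose_spec.1.2
      le_inf := fun a b c h1 h2 => (hinf b c).choose_spec.2 ⟨h1, h2⟩ }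
  letI : OrderBot V := { bot := h.1.choose, bot_le := h.1.choose_spec }
  letI : PredOrder V :=
    { pred := fun a => if ha : ∃ c, c < a then (hpred a ha).choose else a
      pred_le := fun a => by
        split_ifs with ha
        · exact le_of_lt (hpred a ha).choose_spec.1
        · exact le_rfl
      min_of_le_pred := fun {a} hle => by
        split_ifs at hle with ha
        · exact absurd (lt_of_lt_of_le (hpred a ha).choose_spec.1 hle) (lt_irrefl _)
        · intro b hb
          by_contra hc
          exact ha ⟨b, lt_of_le_not_ge hb hc⟩
      le_pred_of_lt := fun {a b} hab => by
        have ha : ∃ c, c < b := ⟨a, hab⟩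
        simp only [dif_pos ha]
        exact (hpred b ha).choose_spec.2 hab }
  { α := V, finite := ‹Finite V› }

/-- `toFinTree V` has the vertices and the order of `V`. -/
noncomputable def toFinTreeIso (V : Type) [PartialOrder V] [Finite V] (h : IsTreeOrder V) :
    toFinTree V h ≃o V where
  toFun x := x
  invFun x := x
  left_inv _ := rfl
  right_inv _ := rfl
  map_rel_iff' := Iff.rfl

theorem isTreeOrder_unit : IsTreeOrder PUnit :=
  ⟨⟨⟨⟩, fun _ => le_rfl⟩, fun _ _ _ _ _ => Or.inl le_rfl⟩

open Classical in
/-- The isomorphism class of the rooted tree with ancestor order `V` (a junk value if there is no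
such tree). -/
noncomputable def cls (V : Type) [PartialOrder V] [Finite V] : Tree :=
  if h : IsTreeOrder V then Quotient.mk FinTree.setoid (toFinTree V h)
  else Quotient.mk FinTree.setoid (toFinTree PUnit isTreeOrder_unit)

theorem IsTreeOrder.of_iso {V W : Type} [PartialOrder V] [PartialOrder W] (e : V ≃o W)
    (h : IsTreeOrder V) : IsTreeOrder W := by
  obtain ⟨⟨r, hr⟩, h2⟩ := h
  refine ⟨⟨e r, fun w => ?_⟩, fun a b v ha hb => ?_⟩
  · rw [← e.le_symm_apply]; exact (hr _)
  · have := h2 (e.symm a) (e.symm b) (e.symm v) (by simpa using ha) (by simpa using hb)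
    simpa using this

theorem cls_congr {V W : Type} [PartialOrder V] [Finite V] [PartialOrder W] [Finite W]
    (e : V ≃o W) : cls V = cls W := by
  unfold cls
  by_cases h : IsTreeOrder V
  · have h' := h.of_iso e
    rw [dif_pos h, dif_pos h']
    exact Quotient.sound ⟨(toFinTreeIso V h).trans (e.trans (toFinTreeIso W h').symm)⟩
  · have h' : ¬ IsTreeOrder W := fun h' => h (h'.of_iso e.symm)
    rw [dif_neg h, dif_neg h']

theorem nonempty_rep_cls {V : Type} [PartialOrder V] [Finite V] (h : IsTreeOrder V) :
    Nonempty (V ≃o (cls V).rep) := by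
  have : Quotient.mk FinTree.setoid (cls V).rep
      = Quotient.mk FinTree.setoid (toFinTree V h) := by
    rw [Tree.rep, Quotient.out_eq, cls, dif_pos h]
  obtain ⟨e⟩ := Quotient.exact this
  exact ⟨(toFinTreeIso V h).symm.trans e.symm⟩

theorem cls_rep (t : Tree) : cls t.rep = t := by
  rw [cls, dif_pos t.rep.isTreeOrder]
  conv_rhs => rw [← Quotient.out_eq t]
  exact Quotient.sound ⟨toFinTreeIso _ _⟩

theorem cls_eq_iff {V : Type} [PartialOrder V] [Finite V] (h : IsTreeOrder V) (t : Tree) :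
    cls V = t ↔ Nonempty (V ≃o t.rep) := by
  constructor
  · rintro rfl; exact nonempty_rep_cls h
  · rintro ⟨e⟩; rw [cls_congr e, cls_rep]

theorem order_cls {V : Type} [PartialOrder V] [Finite V] (h : IsTreeOrder V) :
    (cls V).order = Nat.card V := by
  obtain ⟨e⟩ := nonempty_rep_cls h
  exact (Nat.card_congr e.toEquiv).symm

theorem Tree.order_pos (t : Tree) : 0 < t.order := by
  have : Nonempty t.rep := ⟨⊥⟩
  exact Nat.card_pos

/-- The vertices of `V ∪_v S` are those of `V` and those of `S`. -/
def graftEquiv (V : Type) (v : V) (S : Type) : V ⊕ S ≃ Graft V v S where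
  toFun := Sum.elim Graft.inl Graft.inr
  invFun
    | .inl a => .inl a
    | .inr b => .inr b
  left_inv := by rintro (a | a) <;> rfl
  right_inv := by rintro (a | a) <;> rfl

instance (V : Type) [Finite V] (v : V) (S : Type) [Finite S] : Finite (Graft V v S) :=
  Finite.of_equiv _ (graftEquiv V v S)

section Graft

variable {V S : Type} [PartialOrder V] [PartialOrder S] {v : V}

@[simp] theorem inl_le_inl {a b : V} :
    (Graft.inl a : Graft V v S) ≤ (Graft.inl b : Graft V v S) ↔ a ≤ b := Iff.rfl

@[simp] theorem inl_le_inr {a : V} {b : S} :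
    (Graft.inl a : Graft V v S) ≤ (Graft.inr b : Graft V v S) ↔ a ≤ v := Iff.rfl

@[simp] theorem inr_le_inl {a : V} {b : S} :
    (Graft.inr b : Graft V v S) ≤ (Graft.inl a : Graft V v S) ↔ False := Iff.rfl

@[simp] theorem inr_le_inr {a b : S} :
    (Graft.inr a : Graft V v S) ≤ (Graft.inr b : Graft V v S) ↔ a ≤ b := Iff.rfl

theorem IsTreeOrder.graft (hV : IsTreeOrder V) (hS : IsTreeOrder S) (v : V) :
    IsTreeOrder (Graft V v S) := by
  obtain ⟨⟨r, hr⟩, h2⟩ := hV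
  refine ⟨⟨.inl r, ?_⟩, ?_⟩
  · rintro (a | a)
    · exact hr a
    · exact hr v
  · rintro (a | a) (b | b) (c | c) h h'
    · exact h2 a b c h h'
    · exact h2 a b v h h'
    · exact h'.elim
    · exact Or.inl h
    · exact h.elim
    · exact Or.inr h'
    · exact h.elim
    · exact hS.2 a b c h h'

end Graft

theorem IsTreeOrder.branch {V : Type} [PartialOrder V] (hV : IsTreeOrder V) (v : V) :
    IsTreeOrder {w : V // v ≤ w} :=
  ⟨⟨⟨v, le_rfl⟩, fun w => w.2⟩, fun a b c h h' => hV.2 a b c h h'⟩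

theorem IsTreeOrder.trunk {V : Type} [PartialOrder V] (hV : IsTreeOrder V) {v : V}
    (hv : ¬ IsBot v) : IsTreeOrder {w : V // ¬ v ≤ w} := by
  obtain ⟨⟨r, hr⟩, h2⟩ := hV
  refine ⟨⟨⟨r, fun h => hv fun w => h.trans (hr w)⟩, fun w => hr w⟩, fun a b c h h' => h2 a b c h h'⟩

/-- Grafting is compatible with isomorphisms. -/
def graftCongr {V V' S S' : Type} [PartialOrder V] [PartialOrder V'] [PartialOrder S]
    [PartialOrder S'] (e : V ≃o V') (f : S ≃o S') (v : V) : Graft V v S ≃o Graft V' (e v) S' where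
  toEquiv := (graftEquiv _ _ _).symm.trans
    ((Equiv.sumCongr e.toEquiv f.toEquiv).trans (graftEquiv _ _ _))
  map_rel_iff' := by
    rintro (a | a) (b | b)
    · exact e.le_iff_le
    · exact e.le_iff_le
    · exact Iff.rfl
    · exact f.le_iff_le

/-- Isomorphism of subtrees induced by an isomorphism. -/
def subCongr {V W : Type} [PartialOrder V] [PartialOrder W] (e : V ≃o W) (p : V → Prop)
    (q : W → Prop) (h : ∀ v, p v ↔ q (e v)) : {v // p v} ≃o {w // q w} where
  toEquiv := e.toEquiv.subtypeEquiv h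
  map_rel_iff' := e.le_iff_le

theorem β_cls {V S : Type} [PartialOrder V] [PartialOrder S] [Finite V] [Finite S]
    (hV : IsTreeOrder V) (hS : IsTreeOrder S) (r : Tree) :
    β r (cls S) (cls V) = Nat.card {v : V // cls (Graft V v S) = r} := by
  obtain ⟨e⟩ := nonempty_rep_cls hV
  obtain ⟨f⟩ := nonempty_rep_cls hS
  refine (Nat.card_congr (e.toEquiv.subtypeEquiv fun v => ?_)).symm
  rw [cls_eq_iff (hV.graft hS v)]
  exact ⟨fun ⟨g⟩ => ⟨g.symm.trans (graftCongr e f v)⟩,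
    fun ⟨g⟩ => ⟨(graftCongr e f v).trans g.symm⟩⟩

theorem isBot_congr {V W : Type} [PartialOrder V] [PartialOrder W] (e : V ≃o W) (v : V) :
    IsBot v ↔ IsBot (e v) :=
  ⟨fun h w => by rw [← e.le_symm_apply]; exact h _,
    fun h w => e.le_iff_le.1 (h _)⟩

theorem α_cls {V : Type} [PartialOrder V] [Finite V] (hV : IsTreeOrder V) (t r : Tree) :
    α t (cls V) r = Nat.card {v : V //
      (¬ IsBot v ∧ cls {w // v ≤ w} = t) ∧ cls {w // ¬ v ≤ w} = r} := by
  obtain ⟨e⟩ := nonempty_rep_cls hV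
  refine (Nat.card_congr (e.toEquiv.subtypeEquiv fun v => ?_)).symm
  have h1 : ¬ IsBot v ↔ e.toEquiv v ≠ ⊥ := by
    rw [isBot_congr e, isBot_iff_eq_bot]; rfl
  by_cases hv : IsBot v
  · have h2 : ¬ e.toEquiv v ≠ ⊥ := fun h => (h1.2 h) hv
    exact iff_of_false (fun h => h.1.1 hv) (fun h => h2 h.1)
  · rw [cls_eq_iff (hV.trunk hv), cls_eq_iff (hV.branch v), ← h1]
    have e1 : {w // ¬ v ≤ w} ≃o {w // ¬ e.toEquiv v ≤ w} :=
      subCongr e _ _ fun w => not_congr e.le_iff_le.symm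
    have e2 : {w // v ≤ w} ≃o {w // e.toEquiv v ≤ w} :=
      subCongr e _ _ fun w => e.le_iff_le.symm
    constructor
    · rintro ⟨⟨_, ⟨g⟩⟩, ⟨g'⟩⟩
      exact ⟨hv, ⟨e1.symm.trans g'⟩, ⟨e2.symm.trans g⟩⟩
    · rintro ⟨_, ⟨g'⟩, ⟨g⟩⟩
      exact ⟨⟨hv, ⟨e2.trans g⟩⟩, ⟨e1.trans g'⟩⟩

/-- The vector space with basis `𝕋`, on which insertion and elimination of trees act. -/
abbrev TreeSpace : Type 1 := Tree →₀ ℂ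

instance (V : Type) [Fintype V] (v : V) (S : Type) [Fintype S] : Fintype (Graft V v S) :=
  Fintype.ofEquiv _ (graftEquiv V v S)

theorem sum_graft {V S : Type} [Fintype V] [Fintype S] (v : V) (f : Graft V v S → TreeSpace) :
    ∑ x, f x = ∑ a, f (.inl a) + ∑ b, f (.inr b) := by
  rw [← (graftEquiv V v S).sum_comp, Fintype.sum_sum_type]
  rfl

open Classical in
theorem sum_subtype_dite {V : Type} [Fintype V] (p : V → Prop) [Fintype {v // p v}]
    (f : {v // p v} → TreeSpace) :
    ∑ v, f v = ∑ v : V, if h : p v then f ⟨v, h⟩ else 0 := by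
  have h1 := Finset.sum_subtype (F := inferInstanceAs (Fintype {v // p v}))
    (Finset.univ.filter p) (p := p) (by simp) (fun v => if h : p v then f ⟨v, h⟩ else 0)
  have h2 : ∑ v ∈ Finset.univ.filter p, (if h : p v then f ⟨v, h⟩ else 0)
      = ∑ v : V, if h : p v then f ⟨v, h⟩ else 0 := by
    rw [Finset.sum_filter]
    refine Finset.sum_congr rfl fun v _ => ?_
    by_cases h : p v <;> simp [h]
  rw [← h2, h1]
  refine Finset.sum_congr rfl fun v _ => ?_
  rw [dif_pos v.2]

section Sums

variable {M : Type*} [AddCommGroup M] [Module ℂ M]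

open Classical in
theorem finsum_card {V : Type} [Fintype V] (p : V → Prop) (g : V → Tree) (X : Tree → M) :
    ∑ᶠ r, (Nat.card {v // p v ∧ g v = r} : ℂ) • X r = ∑ v, if p v then X (g v) else 0 := by
  have h : ∀ r, (Nat.card {v // p v ∧ g v = r} : ℂ) • X r
      = ∑ v, if p v ∧ g v = r then X r else 0 := fun r => by
    rw [Nat.card_eq_fintype_card, Fintype.card_subtype, Finset.card_filter, Nat.cast_sum,
      Finset.sum_smul]
    refine Finset.sum_congr rfl fun v _ => ?_
    split_ifs <;> simp
  simp_rw [h]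
  rw [finsum_sum_comm]
  · refine Finset.sum_congr rfl fun v _ => ?_
    rw [finsum_eq_single _ (g v)]
    · simp
    · intro r hr
      rw [if_neg fun h => hr h.2.symm]
  · intro v _
    refine (Set.finite_singleton (g v)).subset fun r hr => ?_
    by_contra hne
    exact hr (if_neg fun h => hne h.2.symm)

theorem ins_cls {V S : Type} [PartialOrder V] [PartialOrder S] [Fintype V] [Fintype S]
    (hV : IsTreeOrder V) (hS : IsTreeOrder S) (X : Tree → M) :
    ∑ᶠ r, (β r (cls S) (cls V) : ℂ) • X r = ∑ v, X (cls (Graft V v S)) := by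
  have := finsum_card (fun _ : V => True) (fun v => cls (Graft V v S)) X
  simpa [β_cls hV hS] using this

open Classical in
theorem elim_cls {V : Type} [PartialOrder V] [Fintype V] (hV : IsTreeOrder V) (t : Tree)
    (X : Tree → M) :
    ∑ᶠ r, (α t (cls V) r : ℂ) • X r
      = ∑ v : V, if ¬ IsBot v ∧ cls {w // v ≤ w} = t then X (cls {w // ¬ v ≤ w}) else 0 := by
  have := finsum_card (fun v : V => ¬ IsBot v ∧ cls {w // v ≤ w} = t)
    (fun v => cls {w // ¬ v ≤ w}) X
  simp only [α_cls hV]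
  convert this

end Sums

/-- Insertion of `t`. -/
noncomputable def P (t : Tree) : TreeSpace →ₗ[ℂ] TreeSpace :=
  Finsupp.linearCombination ℂ fun u => ∑ᶠ r, (β r t u : ℂ) • Finsupp.single r 1

/-- Elimination of `t`. -/
noncomputable def Q (t : Tree) : TreeSpace →ₗ[ℂ] TreeSpace :=
  Finsupp.linearCombination ℂ fun u => ∑ᶠ r, (α t u r : ℂ) • Finsupp.single r 1

/-- Multiplication by the number of vertices. -/
noncomputable def N : TreeSpace →ₗ[ℂ] TreeSpace :=
  Finsupp.linearCombination ℂ fun u => (u.order : ℂ) • Finsupp.single u 1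

/-- The basis vector of a tree. -/
noncomputable def e (V : Type) [PartialOrder V] [Finite V] : TreeSpace := Finsupp.single (cls V) 1

theorem e_congr {V W : Type} [PartialOrder V] [Finite V] [PartialOrder W] [Finite W]
    (f : V ≃o W) : e V = e W := by rw [e, e, cls_congr f]

theorem P_e {V S : Type} [PartialOrder V] [PartialOrder S] [Fintype V] [Fintype S]
    (hV : IsTreeOrder V) (hS : IsTreeOrder S) : P (cls S) (e V) = ∑ v, e (Graft V v S) := by
  rw [P, e, Finsupp.linearCombination_single, one_smul, ins_cls hV hS]
  rfl

open Classical in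
theorem Q_e {V : Type} [PartialOrder V] [Fintype V] (hV : IsTreeOrder V) (t : Tree) :
    Q t (e V) = ∑ v : V, if ¬ IsBot v ∧ cls {w // v ≤ w} = t then e {w // ¬ v ≤ w} else 0 := by
  rw [Q, e, Finsupp.linearCombination_single, one_smul, elim_cls hV]
  rfl

theorem N_e {V : Type} [PartialOrder V] [Fintype V] (hV : IsTreeOrder V) :
    N (e V) = (Fintype.card V : ℂ) • e V := by
  rw [N, e, Finsupp.linearCombination_single, one_smul, order_cls hV, Nat.card_eq_fintype_card]

open Classical in
theorem finsum_Q_e {V : Type} [PartialOrder V] [Fintype V] (hV : IsTreeOrder V) (c : Tree → ℂ) :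
    ∑ᶠ r, c r • Q r (e V)
      = ∑ v : V, if ¬ IsBot v then c (cls {w // v ≤ w}) • e {w // ¬ v ≤ w} else 0 := by
  simp_rw [Q_e hV, Finset.smul_sum]
  rw [finsum_sum_comm]
  · refine Finset.sum_congr rfl fun v _ => ?_
    rw [finsum_eq_single _ (cls {w // v ≤ w})]
    · by_cases h : IsBot v <;> simp [h]
    · intro r hr
      rw [if_neg fun h => hr h.2.symm, smul_zero]
  · intro v _
    refine (Set.finite_singleton (cls {w // v ≤ w})).subset fun r hr => ?_
    by_contra hne
    refine hr ?_
    dsimp only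
    rw [if_neg fun h => hne h.2.symm, smul_zero]

theorem exists_cls_eq {V W : Type} [PartialOrder V] [Finite V] [Finite W] (f : V ≃ W) :
    ∃ o : PartialOrder W, @cls W o _ = cls V := by
  let o : PartialOrder W := PartialOrder.lift f.symm f.symm.injective
  refine ⟨o, (cls_congr { toEquiv := f, map_rel_iff' := ?_ }).symm⟩
  intro a b
  change f.symm (f a) ≤ f.symm (f b) ↔ _
  simp

theorem finite_order_le (n : ℕ) : {t : Tree | t.order ≤ n}.Finite := by
  have hfin : ∀ k : ℕ, Finite (PartialOrder (Fin k)) := fun k =>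
    Finite.of_injective (fun o : PartialOrder (Fin k) => o.le) fun o o' h => by
      exact PartialOrder.ext fun x y => by rw [show o.le = o'.le from h]
  let F : (Σ k : Fin (n + 1), PartialOrder (Fin k)) → Tree := fun x => @cls (Fin x.1) x.2 _
  refine (Set.finite_range F).subset fun t ht => ?_
  have ht' : Nat.card t.rep < n + 1 := Nat.lt_succ_of_le ht
  obtain ⟨o, ho⟩ := exists_cls_eq (Finite.equivFin t.rep)
  exact ⟨⟨⟨Nat.card t.rep, ht'⟩, o⟩, ho.trans (cls_rep t)⟩

theorem α_order {t s r : Tree} (h : α t s r ≠ 0) : s.order = t.order + r.order := by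
  obtain ⟨v, hv, ⟨f⟩, ⟨g⟩⟩ := (Nat.card_ne_zero.1 h).1
  rw [Tree.order, Tree.order, Tree.order, ← Nat.card_congr f.toEquiv, ← Nat.card_congr g.toEquiv,
    ← Nat.card_sum]
  classical
  exact Nat.card_congr (Equiv.sumCompl fun w => v ≤ w).symm

theorem β_order {r s t : Tree} (h : β r s t ≠ 0) : r.order = t.order + s.order := by
  obtain ⟨v, ⟨f⟩⟩ := (Nat.card_ne_zero.1 h).1
  rw [Tree.order, Nat.card_congr f.toEquiv, ← Nat.card_congr (graftEquiv _ _ _), Nat.card_sum]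
  rfl

theorem finite_α_right (s t : Tree) : (Function.support fun r => (α s t r : ℂ)).Finite :=
  (finite_order_le t.order).subset fun r hr => by
    have := α_order (Nat.cast_ne_zero.1 hr)
    change r.order ≤ t.order
    omega

theorem finite_α_mid (s t : Tree) : (Function.support fun r => (α s r t : ℂ)).Finite :=
  (finite_order_le (s.order + t.order)).subset fun _ hr => (α_order (Nat.cast_ne_zero.1 hr)).le

theorem finite_β_left (s t : Tree) : (Function.support fun r => (β r s t : ℂ)).Finite :=
  (finite_order_le (t.order + s.order)).subset fun _ hr => (β_order (Nat.cast_ne_zero.1 hr)).le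

theorem finite_β_right (s t : Tree) : (Function.support fun r => (β s t r : ℂ)).Finite :=
  (finite_order_le s.order).subset fun r hr => by
    have := β_order (Nat.cast_ne_zero.1 hr)
    change r.order ≤ s.order
    omega
theorem finsum_sub_smul {M : Type*} [AddCommGroup M] [Module ℂ M] {c c' : Tree → ℂ}
    (h : (Function.support c).Finite) (h' : (Function.support c').Finite) (X : Tree → M) :
    ∑ᶠ r, (c r - c' r) • X r = ∑ᶠ r, c r • X r - ∑ᶠ r, c' r • X r := by
  rw [← finsum_sub_distrib]
  · simp_rw [sub_smul]
  · exact h.subset (Function.support_smul_subset_left _ _)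
  · exact h'.subset (Function.support_smul_subset_left _ _)

section Iso

variable {U S T : Type} [PartialOrder U] [PartialOrder S] [PartialOrder T]

/-- `(U ∪_v T) ∪_w S = (U ∪_w S) ∪_v T` for vertices `v`, `w` of `U`. -/
def graftSwap (v w : U) :
    Graft (Graft U v T) (.inl w) S ≃o Graft (Graft U w S) (.inl v) T where
  toFun
    | .inl (.inl a) => .inl (.inl a)
    | .inl (.inr a) => .inr a
    | .inr a => .inl (.inr a)
  invFun
    | .inl (.inl a) => .inl (.inl a)
    | .inl (.inr a) => .inr a
    | .inr a => .inl (.inr a)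
  left_inv := by rintro ((a | a) | a) <;> rfl
  right_inv := by rintro ((a | a) | a) <;> rfl
  map_rel_iff' := by rintro ((a | a) | a) ((b | b) | b) <;> exact Iff.rfl

/-- `(U ∪_v T) ∪_w S = U ∪_v (T ∪_w S)` for a vertex `w` of `T`. -/
def graftAssoc (v : U) (w : T) :
    Graft (Graft U v T) (.inr w) S ≃o Graft U v (Graft T w S) where
  toFun
    | .inl (.inl a) => .inl a
    | .inl (.inr a) => .inr (.inl a)
    | .inr a => .inr (.inr a)
  invFun
    | .inl a => .inl (.inl a)
    | .inr (.inl a) => .inl (.inr a)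
    | .inr (.inr a) => .inr a
  left_inv := by rintro ((a | a) | a) <;> rfl
  right_inv := by rintro (a | (a | a)) <;> rfl
  map_rel_iff' := by rintro ((a | a) | a) ((b | b) | b) <;> exact Iff.rfl

/-- A part of `U ∪_v T` that contains `v` and `T`. -/
def subGraftIso (v : U) (p : Graft U v T → Prop) (q : U → Prop) (hq : ∀ a, p (.inl a) ↔ q a)
    (ht : ∀ b, p (.inr b)) (hv : q v) : {x // p x} ≃o Graft {a // q a} ⟨v, hv⟩ T where
  toFun
    | ⟨.inl a, h⟩ => .inl ⟨a, (hq a).1 h⟩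
    | ⟨.inr b, _⟩ => .inr b
  invFun
    | .inl a => ⟨.inl a.1, (hq a.1).2 a.2⟩
    | .inr b => ⟨.inr b, ht b⟩
  left_inv := by rintro ⟨a | a, h⟩ <;> rfl
  right_inv := by rintro (a | a) <;> rfl
  map_rel_iff' := by rintro ⟨a | a, h⟩ ⟨b | b, h'⟩ <;> exact Iff.rfl

/-- A part of `U ∪_v T` that contains `U`. -/
def subGraftIso' (v : U) (p : Graft U v T → Prop) (q : T → Prop) (hq : ∀ a, p (.inr a) ↔ q a)
    (ht : ∀ b, p (.inl b)) : {x // p x} ≃o Graft U v {a // q a} where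
  toFun
    | ⟨.inr a, h⟩ => .inr ⟨a, (hq a).1 h⟩
    | ⟨.inl b, _⟩ => .inl b
  invFun
    | .inr a => ⟨.inr a.1, (hq a.1).2 a.2⟩
    | .inl b => ⟨.inl b, ht b⟩
  left_inv := by rintro ⟨a | a, h⟩ <;> rfl
  right_inv := by rintro (a | a) <;> rfl
  map_rel_iff' := by rintro ⟨a | a, h⟩ ⟨b | b, h'⟩ <;> exact Iff.rfl

/-- A part of `U ∪_v T` inside `U`. -/
def subInlIso (v : U) (p : Graft U v T → Prop) (q : U → Prop) (hq : ∀ a, p (.inl a) ↔ q a)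
    (ht : ∀ b, ¬ p (.inr b)) : {x // p x} ≃o {a // q a} where
  toFun
    | ⟨.inl a, h⟩ => ⟨a, (hq a).1 h⟩
    | ⟨.inr b, h⟩ => (ht b h).elim
  invFun a := ⟨.inl a.1, (hq a.1).2 a.2⟩
  left_inv := by
    rintro ⟨a | a, h⟩
    · rfl
    · exact (ht a h).elim
  right_inv a := rfl
  map_rel_iff' := by
    rintro ⟨a | a, h⟩ ⟨b | b, h'⟩
    · exact Iff.rfl
    · exact (ht b h').elim
    · exact (ht a h).elim
    · exact (ht a h).elim

/-- A part of `U ∪_v T` inside `T`. -/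
def subInrIso (v : U) (p : Graft U v T → Prop) (q : T → Prop) (hq : ∀ a, p (.inr a) ↔ q a)
    (ht : ∀ b, ¬ p (.inl b)) : {x // p x} ≃o {a // q a} where
  toFun
    | ⟨.inr a, h⟩ => ⟨a, (hq a).1 h⟩
    | ⟨.inl b, h⟩ => (ht b h).elim
  invFun a := ⟨.inr a.1, (hq a.1).2 a.2⟩
  left_inv := by
    rintro ⟨a | a, h⟩
    · exact (ht a h).elim
    · rfl
  right_inv a := rfl
  map_rel_iff' := by
    rintro ⟨a | a, h⟩ ⟨b | b, h'⟩
    · exact (ht a h).elim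
    · exact (ht a h).elim
    · exact (ht b h').elim
    · exact Iff.rfl

/-- The whole order. -/
def subTopIso (p : U → Prop) (hp : ∀ a, p a) : {x // p x} ≃o U where
  toFun x := x.1
  invFun x := ⟨x, hp x⟩
  left_inv _ := rfl
  right_inv _ := rfl
  map_rel_iff' := Iff.rfl

/-- A subtype of a subtype. -/
def subSubIso (p : U → Prop) (q : {x // p x} → Prop) (r : U → Prop)
    (h : ∀ a, (∃ h : p a, q ⟨a, h⟩) ↔ r a) : {x // q x} ≃o {a // r a} where
  toFun x := ⟨x.1.1, (h _).1 ⟨x.1.2, x.2⟩⟩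
  invFun a := ⟨⟨a.1, ((h _).2 a.2).1⟩, ((h _).2 a.2).2⟩
  left_inv _ := rfl
  right_inv _ := rfl
  map_rel_iff' := Iff.rfl

end Iso

theorem P_P_aux {U S T : Type} [PartialOrder U] [PartialOrder S] [PartialOrder T] [Fintype U]
    [Fintype S] [Fintype T] (hU : IsTreeOrder U) (hS : IsTreeOrder S) (hT : IsTreeOrder T) :
    P (cls S) (P (cls T) (e U)) = (∑ v : U, ∑ w : U, e (Graft (Graft U v T) (.inl w) S))
      + ∑ᶠ r, (β r (cls S) (cls T) : ℂ) • P r (e U) := by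
  rw [ins_cls hT hS (fun r => P r (e U)), P_e hU hT, map_sum]
  simp_rw [P_e (hU.graft hT _) hS, sum_graft, Finset.sum_add_distrib]
  congr 1
  rw [Finset.sum_comm]
  refine Finset.sum_congr rfl fun w _ => ?_
  rw [P_e hU (hT.graft hS w)]
  exact Finset.sum_congr rfl fun v _ => e_congr (graftAssoc v w)

theorem exists_e (u : Tree) : ∃ (U : Type) (_ : PartialOrder U) (_ : Fintype U),
    IsTreeOrder U ∧ cls U = u :=
  ⟨u.rep, inferInstance, Fintype.ofFinite _, u.rep.isTreeOrder, cls_rep u⟩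

theorem P_P (s t u : Tree) :
    P s (P t (Finsupp.single u 1)) - P t (P s (Finsupp.single u 1))
      = ∑ᶠ r, ((β r s t : ℂ) - β r t s) • P r (Finsupp.single u 1) := by
  obtain ⟨U, _, _, hU, rfl⟩ := exists_e u
  obtain ⟨S, _, _, hS, rfl⟩ := exists_e s
  obtain ⟨T, _, _, hT, rfl⟩ := exists_e t
  rw [finsum_sub_smul (finite_β_left _ _) (finite_β_left _ _)]
  change P _ (P _ (e U)) - P _ (P _ (e U)) = _
  rw [P_P_aux hU hS hT, P_P_aux hU hT hS]
  have : ∑ v : U, ∑ w : U, e (Graft (Graft U v T) (.inl w) S)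
      = ∑ v : U, ∑ w : U, e (Graft (Graft U v S) (.inl w) T) := by
    rw [Finset.sum_comm]
    exact Finset.sum_congr rfl fun w _ => Finset.sum_congr rfl fun v _ => e_congr (graftSwap v w)
  rw [this]
  simp only [e]
  abel

theorem not_isBot_trunk {U : Type} [PartialOrder U] (hU : IsTreeOrder U) {v : U} (hv : ¬ IsBot v)
    (w : {w // ¬ v ≤ w}) : IsBot w ↔ IsBot w.1 := by
  obtain ⟨⟨r, hr⟩, -⟩ := hU
  refine ⟨fun h x => ?_, fun h x => h x.1⟩
  have h1 : w.1 ≤ r := h ⟨r, fun h => hv fun w => h.trans (hr w)⟩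
  exact h1.trans (hr x)

theorem isBot_branch {U : Type} [PartialOrder U] {v : U} (w : {w // v ≤ w}) :
    IsBot w ↔ w.1 ≤ v :=
  ⟨fun h => h ⟨v, le_rfl⟩, fun h x => h.trans x.2⟩

open Classical in
theorem Q_Q_aux {U : Type} [PartialOrder U] [Fintype U] (hU : IsTreeOrder U) (s t : Tree) :
    Q s (Q t (e U)) = (∑ v : U, ∑ w : U, if (¬ IsBot v ∧ cls {x // v ≤ x} = t) ∧
        (¬ IsBot w ∧ cls {x // w ≤ x} = s) ∧ ¬ v ≤ w ∧ ¬ w ≤ v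
        then e {x // ¬ v ≤ x ∧ ¬ w ≤ x} else 0)
      + ∑ᶠ r, (α t r s : ℂ) • Q r (e U) := by
  rw [finsum_Q_e hU fun r => (α t r s : ℂ), Q_e hU, map_sum]
  have h1 : ∀ w : U, (if ¬ IsBot w then (α t (cls {x // w ≤ x}) s : ℂ) • e {x // ¬ w ≤ x} else 0)
      = ∑ v : U, if ¬ IsBot w ∧ w ≤ v ∧ ¬ v ≤ w ∧ cls {x // v ≤ x} = t ∧
          cls {x // w ≤ x ∧ ¬ v ≤ x} = s then e {x // ¬ w ≤ x} else 0 := by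
    intro w
    by_cases hw : IsBot w
    · simp [hw]
    · rw [if_pos hw, α_cls (hU.branch w), Nat.card_eq_fintype_card, Fintype.card_subtype,
        Finset.card_filter, Nat.cast_sum, Finset.sum_smul, sum_subtype_dite]
      refine Finset.sum_congr rfl fun v _ => ?_
      by_cases h : w ≤ v
      · have e1 : cls {x : {x // w ≤ x} // (⟨v, h⟩ : {x // w ≤ x}) ≤ x} = cls {x // v ≤ x} :=
          cls_congr (subSubIso _ _ _ fun a => ⟨fun h => h.2, fun h' => ⟨h.trans h', h'⟩⟩)
        have e2 : cls {x : {x // w ≤ x} // ¬ (⟨v, h⟩ : {x // w ≤ x}) ≤ x}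
            = cls {x // w ≤ x ∧ ¬ v ≤ x} :=
          cls_congr (subSubIso _ _ _ fun a => ⟨fun h => ⟨h.1, h.2⟩, fun h => ⟨h.1, h.2⟩⟩)
        rw [dif_pos h, isBot_branch, e1, e2]
        by_cases h3 : v ≤ w <;> simp [h, hw, h3]
      · simp [h]
  simp_rw [h1]
  rw [Finset.sum_comm (s := Finset.univ) (t := Finset.univ) (f := fun w v => if ¬ IsBot w ∧ _ then _ else _),
    ← Finset.sum_add_distrib]
  refine Finset.sum_congr rfl fun v _ => ?_
  by_cases hv : ¬ IsBot v ∧ cls {x // v ≤ x} = t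
  · rw [if_pos hv, Q_e (hU.trunk hv.1), sum_subtype_dite, ← Finset.sum_add_distrib]
    refine Finset.sum_congr rfl fun w _ => ?_
    by_cases h : v ≤ w
    · simp [h]
    · have e1 : cls {x : {x // ¬ v ≤ x} // (⟨w, h⟩ : {x // ¬ v ≤ x}) ≤ x}
          = cls {x // w ≤ x ∧ ¬ v ≤ x} :=
        cls_congr (subSubIso _ _ _ fun a => ⟨fun h => ⟨h.2, h.1⟩, fun h => ⟨h.2, h.1⟩⟩)
      have e2 : e {x : {x // ¬ v ≤ x} // ¬ (⟨w, h⟩ : {x // ¬ v ≤ x}) ≤ x}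
          = e {x // ¬ v ≤ x ∧ ¬ w ≤ x} :=
        e_congr (subSubIso _ _ _ fun a => ⟨fun h => ⟨h.1, h.2⟩, fun h => ⟨h.1, h.2⟩⟩)
      rw [dif_pos h, not_isBot_trunk hU hv.1, e1, e2]
      by_cases h3 : w ≤ v
      · have e3 : e {x // ¬ v ≤ x ∧ ¬ w ≤ x} = e {x // ¬ w ≤ x} :=
          e_congr (subCongr (OrderIso.refl U) _ _ fun a =>
            ⟨fun h => h.2, fun h => ⟨fun h' => h (h3.trans h'), h⟩⟩)
        rw [e3]
        simp [h, h3, hv]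
      · have e4 : cls {x // w ≤ x ∧ ¬ v ≤ x} = cls {x // w ≤ x} :=
          cls_congr (subCongr (OrderIso.refl U) _ _ fun a =>
            ⟨fun h => h.1, fun h' => ⟨h', fun h'' => (hU.2 v w a h'' h').elim h h3⟩⟩)
        rw [e4]
        simp [h, h3, hv]
  · rw [if_neg hv, map_zero, ← Finset.sum_add_distrib]
    refine (Finset.sum_eq_zero fun w _ => ?_).symm
    rw [if_neg (fun h => hv h.1), if_neg, add_zero]
    rintro ⟨h1, h2, h3, h4, h5⟩
    exact hv ⟨fun h => h3 (h w), h4⟩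

theorem Q_Q (s t u : Tree) :
    Q s (Q t (Finsupp.single u 1)) - Q t (Q s (Finsupp.single u 1))
      = ∑ᶠ r, ((α t r s : ℂ) - α s r t) • Q r (Finsupp.single u 1) := by
  obtain ⟨U, _, _, hU, rfl⟩ := exists_e u
  rw [finsum_sub_smul (finite_α_mid _ _) (finite_α_mid _ _)]
  change Q _ (Q _ (e U)) - Q _ (Q _ (e U)) = _
  classical
  rw [Q_Q_aux hU s t, Q_Q_aux hU t s, Finset.sum_comm]
  have : ∀ v w : U, e {x // ¬ v ≤ x ∧ ¬ w ≤ x} = e {x // ¬ w ≤ x ∧ ¬ v ≤ x} := fun v w =>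
    e_congr (subCongr (OrderIso.refl U) _ _ fun a => and_comm)
  have h2 : ∀ v w : U, (((¬ IsBot v ∧ cls {x // v ≤ x} = t) ∧
        (¬ IsBot w ∧ cls {x // w ≤ x} = s) ∧ ¬ v ≤ w ∧ ¬ w ≤ v)) ↔ 
        ((¬ IsBot w ∧ cls {x // w ≤ x} = s) ∧
        (¬ IsBot v ∧ cls {x // v ≤ x} = t) ∧ ¬ w ≤ v ∧ ¬ v ≤ w) := fun v w => by tauto
  simp_rw [this, h2]
  simp only [e]
  abel
theorem isBot_inl {U T : Type} [PartialOrder U] [PartialOrder T] {v : U} (w : U) :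
    IsBot (Graft.inl w : Graft U v T) ↔ IsBot w :=
  ⟨fun h x => h (.inl x), fun h x => by
    rcases x with x | x
    · exact h x
    · exact h v⟩

theorem not_isBot_inr {U T : Type} [PartialOrder U] [PartialOrder T] {v : U} (w : T) :
    ¬ IsBot (Graft.inr w : Graft U v T) := fun h => h (.inl v)

open Classical in
theorem Q_P_inl {U T : Type} [PartialOrder U] [PartialOrder T] [Fintype U] [Fintype T]
    (hU : IsTreeOrder U) (hT : IsTreeOrder T) (s : Tree) :
    (∑ v : U, ∑ w : U, if ¬ IsBot (Graft.inl w : Graft U v T) ∧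
        cls {x : Graft U v T // .inl w ≤ x} = s then e {x : Graft U v T // ¬ .inl w ≤ x} else 0)
      = P (cls T) (Q s (e U)) + ∑ᶠ r, (β s (cls T) r : ℂ) • Q r (e U) := by
  rw [finsum_Q_e hU fun r => (β s (cls T) r : ℂ), Q_e hU, map_sum, ← Finset.sum_add_distrib,
    Finset.sum_comm]
  refine Finset.sum_congr rfl fun w _ => ?_
  by_cases hw : IsBot w
  · simp [isBot_inl, hw]
  have h1 : (if ¬ IsBot w then (β s (cls T) (cls {x // w ≤ x}) : ℂ) • e {x // ¬ w ≤ x} else 0)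
      = ∑ v : U, if h : w ≤ v then (if cls (Graft {x // w ≤ x} ⟨v, h⟩ T) = s
          then e {x // ¬ w ≤ x} else 0) else 0 := by
    rw [if_pos hw, β_cls (hU.branch w) hT, Nat.card_eq_fintype_card, Fintype.card_subtype,
      Finset.card_filter, Nat.cast_sum, Finset.sum_smul, sum_subtype_dite]
    refine Finset.sum_congr rfl fun v _ => ?_
    by_cases h : w ≤ v <;> simp [h]
  have h2 : P (cls T) (if ¬ IsBot w ∧ cls {x // w ≤ x} = s then e {x // ¬ w ≤ x} else 0)
      = ∑ v : U, if h : ¬ w ≤ v then (if cls {x // w ≤ x} = s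
          then e (Graft {x // ¬ w ≤ x} ⟨v, h⟩ T) else 0) else 0 := by
    by_cases h : cls {x // w ≤ x} = s
    · rw [if_pos ⟨hw, h⟩, P_e (hU.trunk hw) hT, sum_subtype_dite]
      simp [h]
    · simp [h]
  rw [h1, h2, ← Finset.sum_add_distrib]
  refine Finset.sum_congr rfl fun v _ => ?_
  by_cases h : w ≤ v
  · have e1 : cls {x : Graft U v T // .inl w ≤ x} = cls (Graft {x // w ≤ x} ⟨v, h⟩ T) :=
      cls_congr (subGraftIso v _ _ (fun a => Iff.rfl) (fun _ => h) h)
    have e2 : e {x : Graft U v T // ¬ .inl w ≤ x} = e {x // ¬ w ≤ x} :=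
      e_congr (subInlIso v _ _ (fun a => Iff.rfl) fun _ h' => h' h)
    rw [e1, e2]
    simp [h, hw, isBot_inl]
  · have e1 : cls {x : Graft U v T // .inl w ≤ x} = cls {x // w ≤ x} :=
      cls_congr (subInlIso v _ _ (fun a => Iff.rfl) fun _ h' => h h')
    have e2 : e {x : Graft U v T // ¬ .inl w ≤ x} = e (Graft {x // ¬ w ≤ x} ⟨v, h⟩ T) :=
      e_congr (subGraftIso v _ _ (fun a => Iff.rfl) (fun _ => h) h)
    rw [e1, e2]
    simp [h, hw, isBot_inl]

open Classical in
theorem Q_P_inr {U T : Type} [PartialOrder U] [PartialOrder T] [Fintype U] [Fintype T]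
    (hU : IsTreeOrder U) (hT : IsTreeOrder T) (s : Tree) :
    (∑ v : U, ∑ w : T, if ¬ IsBot (Graft.inr w : Graft U v T) ∧
        cls {x : Graft U v T // .inr w ≤ x} = s then e {x : Graft U v T // ¬ .inr w ≤ x} else 0)
      = ∑ᶠ r, (α s (cls T) r : ℂ) • P r (e U) + if s = cls T then N (e U) else 0 := by
  have h0 : (if s = cls T then N (e U) else 0)
      = ∑ v : U, ∑ w : T, if IsBot w ∧ s = cls T then e U else 0 := by
    obtain ⟨r, hr⟩ := hT.1
    rw [Finset.sum_const, Finset.sum_eq_single r]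
    · by_cases h : s = cls T
      · simp [h, hr, N_e hU, Nat.cast_smul_eq_nsmul]
      · simp [h]
    · intro b _ hb
      rw [if_neg fun h => hb (le_antisymm (h.1 r) (hr b))]
    · simp
  have h1 : ∑ᶠ r, (α s (cls T) r : ℂ) • P r (e U) = ∑ v : U, ∑ w : T,
      if ¬ IsBot w ∧ cls {x // w ≤ x} = s then e (Graft U v {x // ¬ w ≤ x}) else 0 := by
    rw [elim_cls hT s fun r => P r (e U), Finset.sum_comm]
    refine Finset.sum_congr rfl fun w _ => ?_
    by_cases h : ¬ IsBot w ∧ cls {x // w ≤ x} = s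
    · simp_rw [if_pos h]
      exact P_e hU (hT.trunk h.1)
    · simp_rw [if_neg h]
      simp
  rw [h0, h1, ← Finset.sum_add_distrib]
  refine Finset.sum_congr rfl fun v _ => ?_
  rw [← Finset.sum_add_distrib]
  refine Finset.sum_congr rfl fun w _ => ?_
  have e1 : cls {x : Graft U v T // .inr w ≤ x} = cls {x // w ≤ x} :=
    cls_congr (subInrIso v _ _ (fun a => Iff.rfl) fun _ h => h)
  have e2 : e {x : Graft U v T // ¬ .inr w ≤ x} = e (Graft U v {x // ¬ w ≤ x}) :=
    e_congr (subGraftIso' v _ _ (fun a => Iff.rfl) fun _ h => h)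
  by_cases h : IsBot w
  · have e3 : cls {x // w ≤ x} = cls T := cls_congr (subTopIso _ h)
    have e4 : e {x : Graft U v T // ¬ .inr w ≤ x} = e U :=
      e_congr ((subInlIso v _ (fun _ => True) (fun a => iff_of_true (fun h => h) trivial)
        fun b h' => h' (h b)).trans (subTopIso _ fun _ => trivial))
    rw [e1, e3, e4]
    simp [h, not_isBot_inr, eq_comm]
  · rw [e1, e2]
    simp [h, not_isBot_inr]

open Classical in
theorem Q_P (s t u : Tree) :
    Q s (P t (Finsupp.single u 1)) - P t (Q s (Finsupp.single u 1))
      = ∑ᶠ r, (α s t r : ℂ) • P r (Finsupp.single u 1)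
        + ∑ᶠ r, (β s t r : ℂ) • Q r (Finsupp.single u 1)
        + if s = t then N (Finsupp.single u 1) else 0 := by
  obtain ⟨U, _, _, hU, rfl⟩ := exists_e u
  obtain ⟨T, _, _, hT, rfl⟩ := exists_e t
  have h : Q s (P (cls T) (e U)) = P (cls T) (Q s (e U)) +
      ∑ᶠ r, (β s (cls T) r : ℂ) • Q r (e U) +
      (∑ᶠ r, (α s (cls T) r : ℂ) • P r (e U) + if s = cls T then N (e U) else 0) := by
    rw [← Q_P_inl hU hT, ← Q_P_inr hU hT, P_e hU hT, map_sum, ← Finset.sum_add_distrib]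
    refine Finset.sum_congr rfl fun v _ => ?_
    rw [Q_e (hU.graft hT v), sum_graft]
  change Q s (P (cls T) (e U)) - _ = _
  rw [h]
  simp only [e]
  abel

theorem N_single (u : Tree) : N (Finsupp.single u 1) = (u.order : ℂ) • Finsupp.single u 1 := by
  rw [N, Finsupp.linearCombination_single, one_smul]

theorem N_P (t u : Tree) : N (P t (Finsupp.single u 1)) - P t (N (Finsupp.single u 1))
    = (t.order : ℂ) • P t (Finsupp.single u 1) := by
  obtain ⟨U, _, _, hU, rfl⟩ := exists_e u
  obtain ⟨T, _, _, hT, rfl⟩ := exists_e t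
  change N (P _ (e U)) - P _ (N (e U)) = _ • P _ (e U)
  rw [N_e hU, map_smul, P_e hU hT, map_sum, Finset.smul_sum, Finset.smul_sum,
    ← Finset.sum_sub_distrib]
  refine Finset.sum_congr rfl fun v _ => ?_
  rw [N_e (hU.graft hT v), order_cls hT, ← sub_smul, ← Nat.card_eq_fintype_card,
    ← Nat.card_congr (graftEquiv U v T), Nat.card_sum, ← Nat.card_eq_fintype_card]
  congr 1
  push_cast
  ring

theorem N_Q (t u : Tree) : N (Q t (Finsupp.single u 1)) - Q t (N (Finsupp.single u 1))
    = -(t.order : ℂ) • Q t (Finsupp.single u 1) := by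
  obtain ⟨U, _, _, hU, rfl⟩ := exists_e u
  change N (Q _ (e U)) - Q _ (N (e U)) = _ • Q _ (e U)
  classical
  rw [N_e hU, map_smul, Q_e hU, map_sum, Finset.smul_sum, Finset.smul_sum,
    ← Finset.sum_sub_distrib]
  refine Finset.sum_congr rfl fun v _ => ?_
  by_cases h : ¬ IsBot v ∧ cls {w // v ≤ w} = t
  · rw [if_pos h, N_e (hU.trunk h.1), ← h.2, order_cls (hU.branch v), ← sub_smul]
    congr 1
    have := Fintype.card_congr (Equiv.sumCompl fun w => v ≤ w)
    rw [Fintype.card_sum] at this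
    rw [← this, Nat.card_eq_fintype_card]
    push_cast
    ring
  · simp [h]

/-! ### The insertion-elimination Lie algebra -/

/-- Labels of the basis `{d} ∪ {D_t^+, D_t^- | t ∈ 𝕋}`. -/
inductive Gen : Type 1
  | d : Gen
  | plus (t : Tree) : Gen
  | minus (t : Tree) : Gen

/-- The complex vector space with basis `{d} ∪ {D_t^+, D_t^- | t ∈ 𝕋}`, which carries the
insertion-elimination Lie algebra `𝔤`. -/
def Alg : Type 1 := Gen →₀ ℂ

noncomputable instance : AddCommGroup Alg := inferInstanceAs (AddCommGroup (Gen →₀ ℂ))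

noncomputable instance : Module ℂ Alg := inferInstanceAs (Module ℂ (Gen →₀ ℂ))

/-- The defining basis of `𝔤`. -/
noncomputable def basis : Module.Basis Gen ℂ Alg := ⟨LinearEquiv.refl ℂ (Gen →₀ ℂ)⟩

/-- The element `d`. -/
noncomputable def d : Alg := basis .d

/-- The element `D_t^+`. -/
noncomputable def Dp (t : Tree) : Alg := basis (.plus t)

/-- The element `D_t^-`. -/
noncomputable def Dm (t : Tree) : Alg := basis (.minus t)

open Classical in
/-- The bracket `[D_s^-, D_t^+]`. -/
noncomputable def crossBracket (s t : Tree) : Alg :=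
  ∑ᶠ r, (α s t r : ℂ) • Dp r + ∑ᶠ r, (β s t r : ℂ) • Dm r + if s = t then d else 0

/-- The brackets of the basis elements. All the sums over trees have finite support. -/
noncomputable def genBracket : Gen → Gen → Alg
  | .plus s, .plus t => ∑ᶠ r, ((β r s t : ℂ) - β r t s) • Dp r
  | .minus s, .minus t => ∑ᶠ r, ((α t r s : ℂ) - α s r t) • Dm r
  | .minus s, .plus t => crossBracket s t
  | .plus t, .minus s => -crossBracket s t
  | .d, .minus t => -(t.order : ℂ) • Dm t
  | .minus t, .d => (t.order : ℂ) • Dm t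
  | .d, .plus t => (t.order : ℂ) • Dp t
  | .plus t, .d => -(t.order : ℂ) • Dp t
  | .d, .d => 0

/-- The bilinear extension of `genBracket`. -/
noncomputable def bracket : Alg →ₗ[ℂ] Alg →ₗ[ℂ] Alg :=
  basis.constr ℂ fun a => basis.constr ℂ fun b => genBracket a b

theorem bracket_basis (a b : Gen) : bracket (basis a) (basis b) = genBracket a b := by
  rw [bracket, Module.Basis.constr_basis, Module.Basis.constr_basis]

/-- The action of `𝔤` on the space spanned by the trees. -/
noncomputable def ρ : Alg →ₗ[ℂ] Module.End ℂ TreeSpace :=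
  basis.constr ℂ fun
    | .d => N
    | .plus t => P t
    | .minus t => Q t

theorem ρ_d : ρ d = N := Module.Basis.constr_basis _ _ _ _

theorem ρ_Dp (t : Tree) : ρ (Dp t) = P t := Module.Basis.constr_basis _ _ _ _

theorem ρ_Dm (t : Tree) : ρ (Dm t) = Q t := Module.Basis.constr_basis _ _ _ _

theorem ρ_finsum (c : Tree → ℂ) (hc : (Function.support c).Finite) (X : Tree → Alg)
    (x : TreeSpace) : ρ (∑ᶠ r, c r • X r) x = ∑ᶠ r, c r • ρ (X r) x := by
  have := map_finsum ((LinearMap.applyₗ x).comp ρ)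
    (f := fun r => c r • X r) (hc.subset (Function.support_smul_subset_left c X))
  simpa using this

theorem support_sub_finite {c c' : Tree → ℂ} (h : (Function.support c).Finite)
    (h' : (Function.support c').Finite) : (Function.support fun r => c r - c' r).Finite :=
  (h.union h').subset (Function.support_sub c c')

theorem ρ_cross (s t u : Tree) : ρ (crossBracket s t) (Finsupp.single u 1)
    = Q s (P t (Finsupp.single u 1)) - P t (Q s (Finsupp.single u 1)) := by
  classical
  rw [crossBracket, map_add, map_add, LinearMap.add_apply, LinearMap.add_apply,
    ρ_finsum _ (finite_α_right s t), ρ_finsum _ (finite_β_right s t), Q_P]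
  simp only [ρ_Dp, ρ_Dm]
  congr 1
  split_ifs
  · rw [ρ_d]
  · simp

theorem ρ_genBracket (a b : Gen) (u : Tree) :
    ρ (genBracket a b) (Finsupp.single u 1)
      = ρ (basis a) (ρ (basis b) (Finsupp.single u 1))
        - ρ (basis b) (ρ (basis a) (Finsupp.single u 1)) := by
  rcases a with _ | s | s <;> rcases b with _ | t | t
  · rw [sub_self, genBracket, map_zero]
    rfl
  · change ρ (_ • Dp t) (Finsupp.single u 1) = ρ d (ρ (Dp t) (Finsupp.single u 1))
      - ρ (Dp t) (ρ d (Finsupp.single u 1))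
    rw [ρ_d, map_smul, ρ_Dp, N_P]
    rfl
  · change ρ (_ • Dm t) (Finsupp.single u 1) = ρ d (ρ (Dm t) (Finsupp.single u 1))
      - ρ (Dm t) (ρ d (Finsupp.single u 1))
    rw [ρ_d, map_smul, ρ_Dm, N_Q]
    rfl
  · change ρ (_ • Dp s) (Finsupp.single u 1) = ρ (Dp s) (ρ d (Finsupp.single u 1))
      - ρ d (ρ (Dp s) (Finsupp.single u 1))
    rw [ρ_d, map_smul, ρ_Dp, ← neg_sub, N_P, ← neg_smul]
    rfl
  · change ρ (∑ᶠ r, ((β r s t : ℂ) - β r t s) • Dp r) (Finsupp.single u 1)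
      = ρ (Dp s) (ρ (Dp t) (Finsupp.single u 1)) - ρ (Dp t) (ρ (Dp s) (Finsupp.single u 1))
    rw [ρ_finsum _ (support_sub_finite (finite_β_left s t) (finite_β_left t s))]
    simp only [ρ_Dp]
    exact (P_P s t u).symm
  · change ρ (-crossBracket t s) (Finsupp.single u 1)
      = ρ (Dp s) (ρ (Dm t) (Finsupp.single u 1)) - ρ (Dm t) (ρ (Dp s) (Finsupp.single u 1))
    rw [map_neg, LinearMap.neg_apply, ρ_cross, ρ_Dp, ρ_Dm, neg_sub]
  · change ρ (_ • Dm s) (Finsupp.single u 1) = ρ (Dm s) (ρ d (Finsupp.single u 1))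
      - ρ d (ρ (Dm s) (Finsupp.single u 1))
    rw [ρ_d, map_smul, ρ_Dm, ← neg_sub, N_Q, ← neg_smul, neg_neg]
    rfl
  · change ρ (crossBracket s t) (Finsupp.single u 1)
      = ρ (Dm s) (ρ (Dp t) (Finsupp.single u 1)) - ρ (Dp t) (ρ (Dm s) (Finsupp.single u 1))
    rw [ρ_cross, ρ_Dp, ρ_Dm]
  · change ρ (∑ᶠ r, ((α t r s : ℂ) - α s r t) • Dm r) (Finsupp.single u 1)
      = ρ (Dm s) (ρ (Dm t) (Finsupp.single u 1)) - ρ (Dm t) (ρ (Dm s) (Finsupp.single u 1))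
    rw [ρ_finsum _ (support_sub_finite (finite_α_mid t s) (finite_α_mid s t))]
    simp only [ρ_Dm]
    exact (Q_Q s t u).symm

theorem ρ_bracket (x y : Alg) (v : TreeSpace) :
    ρ (bracket x y) v = ρ x (ρ y v) - ρ y (ρ x v) := by
  have hx : x ∈ Submodule.span ℂ (Set.range basis) := by rw [basis.span_eq]; trivial
  have hy : y ∈ Submodule.span ℂ (Set.range basis) := by rw [basis.span_eq]; trivial
  induction hx using Submodule.span_induction with
  | zero => simp
  | add x x' _ _ h h' =>
    simp only [map_add, LinearMap.add_apply, h, h']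
    abel
  | smul c x _ h => simp only [map_smul, LinearMap.smul_apply, h, smul_sub]
  | mem x hx =>
    obtain ⟨a, rfl⟩ := hx
    induction hy using Submodule.span_induction with
    | zero => simp
    | add y y' _ _ h h' =>
      simp only [map_add, LinearMap.add_apply, h, h']
      abel
    | smul c y _ h => simp only [map_smul, LinearMap.smul_apply, h, smul_sub]
    | mem y hy =>
      obtain ⟨b, rfl⟩ := hy
      induction v using Finsupp.induction_linear with
      | zero => simp
      | add v v' h h' =>
        simp only [map_add, h, h']
        abel
      | single u c =>
        have : (Finsupp.single u c : TreeSpace) = c • Finsupp.single u 1 := by simp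
        rw [this]
        simp only [map_smul, bracket_basis, ρ_genBracket, smul_sub]

/-- The tree with one vertex. -/
noncomputable def pt : Tree := cls PUnit

/-- The tree obtained by adding a new root above the root of `t`. -/
noncomputable def addRoot (t : Tree) : Tree := cls (Graft PUnit ⟨⟩ t.rep)

theorem β_pt {r t : Tree} : β r t pt ≠ 0 ↔ r = addRoot t := by
  have h := β_cls isTreeOrder_unit t.rep.isTreeOrder r
  rw [cls_rep] at h
  rw [pt, h, Nat.card_ne_zero]
  exact ⟨fun ⟨⟨v⟩, _⟩ => v.2.symm, fun h => ⟨⟨⟨⟨⟩, h.symm⟩⟩, inferInstance⟩⟩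

theorem α_addRoot {r t : Tree} : α r (addRoot t) pt ≠ 0 ↔ r = t := by
  rw [addRoot, α_cls (isTreeOrder_unit.graft t.rep.isTreeOrder _), Nat.card_ne_zero]
  constructor
  · rintro ⟨⟨⟨v | v, ⟨hv, h1⟩, h2⟩⟩, -⟩
    · exact (hv (isBot_inl v |>.2 fun _ => le_rfl)).elim
    · have hv : IsBot v := fun b => by
        by_contra hb
        obtain ⟨f⟩ := (cls_eq_iff (IsTreeOrder.trunk
          (isTreeOrder_unit.graft t.rep.isTreeOrder _) hv) pt).1 h2
        obtain ⟨g⟩ := nonempty_rep_cls isTreeOrder_unit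
        have := (f.trans g.symm).injective (a₁ := ⟨.inl ⟨⟩, fun h => h⟩) (a₂ := ⟨.inr b, hb⟩) rfl
        cases this
      rw [← h1, cls_congr (subInrIso _ _ (fun b => v ≤ b) (fun _ => Iff.rfl) fun _ h => h),
        cls_congr (subTopIso _ hv), cls_rep]
  · rintro rfl
    refine ⟨⟨⟨.inr ⊥, ⟨not_isBot_inr _, ?_⟩, ?_⟩⟩, inferInstance⟩
    · rw [cls_congr (subInrIso _ _ (fun b => ⊥ ≤ b) (fun _ => Iff.rfl) fun _ h => h),
        cls_congr (subTopIso _ fun _ => bot_le), cls_rep]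
    · exact cls_congr ((subInlIso _ _ (fun _ => True) (fun a => iff_of_true (fun h => h) trivial)
        fun b h' => h' (bot_le (a := b))).trans (subTopIso _ fun _ => trivial))

theorem finsum_single_apply (c : Tree → ℂ) (hc : (Function.support c).Finite) (q : Tree) :
    (∑ᶠ r, c r • (Finsupp.single r 1 : TreeSpace)) q = c q := by
  have := map_finsum (Finsupp.lapply (R := ℂ) q : TreeSpace →ₗ[ℂ] ℂ)
    (f := fun r => c r • (Finsupp.single r 1 : TreeSpace))
    (hc.subset (Function.support_smul_subset_left c _))
  simp only [Finsupp.lapply_apply] at this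
  rw [this, finsum_eq_single _ q]
  · simp
  · intro r hr
    simp [Finsupp.single_eq_of_ne hr.symm]

theorem P_apply (t u q : Tree) : P t (Finsupp.single u 1) q = β q t u := by
  rw [P, Finsupp.linearCombination_single, one_smul, finsum_single_apply _ (finite_β_left t u)]

theorem Q_apply (t u q : Tree) : Q t (Finsupp.single u 1) q = α t u q := by
  rw [Q, Finsupp.linearCombination_single, one_smul, finsum_single_apply _ (finite_α_right t u)]

theorem ρ_apply (x : Alg) (u q : Tree) : ρ x (Finsupp.single u 1) q
    = (basis.repr x).sum fun a c => c * ρ (basis a) (Finsupp.single u 1) q := by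
  conv_lhs => rw [← basis.linearCombination_repr x, Finsupp.linearCombination_apply, Finsupp.sum,
    map_sum, LinearMap.sum_apply, Finsupp.finsetSum_apply]
  simp only [map_smul, LinearMap.smul_apply, Finsupp.smul_apply, smul_eq_mul]
  rfl

theorem ρ_injective : Function.Injective ρ := by
  rw [injective_iff_map_eq_zero]
  intro x hx
  have key : ∀ u q : Tree,
      ((basis.repr x).sum fun a c => c * ρ (basis a) (Finsupp.single u 1) q) = 0 := fun u q => by
    rw [← ρ_apply, hx]; rfl
  have hQ : ∀ t : Tree, Q t (Finsupp.single pt 1) = 0 := fun t => by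
    ext q
    rw [Q_apply, Finsupp.zero_apply, Nat.cast_eq_zero]
    by_contra h
    have h1 := α_order h
    have h2 : pt.order = 1 := (order_cls isTreeOrder_unit).trans (by simp)
    have h3 := t.order_pos
    have h4 := q.order_pos
    omega
  have single_term : ∀ (u q : Tree) (a : Gen),
      (∀ b, basis.repr x b ≠ 0 → b ≠ a → ρ (basis b) (Finsupp.single u 1) q = 0) →
      ρ (basis a) (Finsupp.single u 1) q ≠ 0 → basis.repr x a = 0 := by
    intro u q a h h'
    have h1 := key u q
    rw [Finsupp.sum, Finset.sum_eq_single a] at h1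
    · exact (mul_eq_zero.1 h1).resolve_right h'
    · intro b hb hne
      rw [h b (Finsupp.mem_support_iff.1 hb) hne, mul_zero]
    · intro ha
      rw [Finsupp.notMem_support_iff.1 ha, zero_mul]
  have pt_order : pt.order = 1 := (order_cls isTreeOrder_unit).trans (by simp)
  have addRoot_inj : ∀ s t, addRoot s = addRoot t → s = t := fun s t h =>
    α_addRoot.1 (h ▸ α_addRoot.2 rfl)
  have addRoot_ne : ∀ t, pt ≠ addRoot t := fun t h => by
    have h1 := β_order (β_pt.2 h)
    have := t.order_pos
    omega
  have hd : basis.repr x .d = 0 := by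
    refine single_term pt pt .d (fun b _ hb => ?_) ?_
    · rcases b with _ | t | t
      · exact (hb rfl).elim
      · change ρ (Dp t) _ _ = 0
        rw [ρ_Dp, P_apply, Nat.cast_eq_zero]
        by_contra h
        exact addRoot_ne t (β_pt.1 h)
      · change ρ (Dm t) _ _ = 0
        rw [ρ_Dm, hQ]
        rfl
    · change ρ d _ _ ≠ 0
      rw [ρ_d, N_single, pt_order]
      simp
  have hp : ∀ t, basis.repr x (.plus t) = 0 := fun t => by
    refine single_term pt (addRoot t) (.plus t) (fun b hb' hb => ?_) ?_
    · rcases b with _ | s | s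
      · exact (hb' hd).elim
      · change ρ (Dp s) _ _ = 0
        rw [ρ_Dp, P_apply, Nat.cast_eq_zero]
        by_contra h
        exact hb (congrArg _ (addRoot_inj _ _ (β_pt.1 h)).symm)
      · change ρ (Dm s) _ _ = 0
        rw [ρ_Dm, hQ]
        rfl
    · change ρ (Dp t) _ _ ≠ 0
      rw [ρ_Dp, P_apply, Nat.cast_ne_zero]
      exact β_pt.2 rfl
  have hm : ∀ t, basis.repr x (.minus t) = 0 := fun t => by
    refine single_term (addRoot t) pt (.minus t) (fun b hb' hb => ?_) ?_
    · rcases b with _ | s | s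
      · exact (hb' hd).elim
      · exact (hb' (hp s)).elim
      · change ρ (Dm s) _ _ = 0
        rw [ρ_Dm, Q_apply, Nat.cast_eq_zero]
        by_contra h
        exact hb (congrArg _ (α_addRoot.1 h))
    · change ρ (Dm t) _ _ ≠ 0
      rw [ρ_Dm, Q_apply, Nat.cast_ne_zero]
      exact α_addRoot.2 rfl
  refine basis.repr.map_eq_zero_iff.1 (Finsupp.ext fun a => ?_)
  rcases a with _ | t | t
  · exact hd
  · exact hp t
  · exact hm t

/-- The insertion-elimination Lie algebra `𝔤`. -/
noncomputable instance : LieRing Alg where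
  bracket x y := bracket x y
  add_lie x y z := by rw [map_add]; rfl
  lie_add x y z := map_add _ _ _
  lie_self x := ρ_injective (by
    ext1
    ext1
    simp only [LinearMap.comp_apply, ρ_bracket, sub_self, map_zero]
    rfl)
  leibniz_lie x y z := ρ_injective (by
    refine LinearMap.ext fun v => ?_
    simp only [map_add, LinearMap.add_apply, ρ_bracket, map_sub]
    abel)

noncomputable instance : LieAlgebra ℂ Alg where
  lie_smul c x y := map_smul (bracket x) c y

theorem lie_basis (a b : Gen) : ⁅basis a, basis b⁆ = genBracket a b := bracket_basis a b

/-! ### Verma modules -/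

open scoped TensorProduct

attribute [local instance] LieRing.ofAssociativeRing

theorem lie_mem_of_span {S : Set Alg} {K : Submodule ℂ Alg}
    (h : ∀ a ∈ S, ∀ b ∈ S, ⁅a, b⁆ ∈ K) {x y : Alg} (hx : x ∈ Submodule.span ℂ S)
    (hy : y ∈ Submodule.span ℂ S) : ⁅x, y⁆ ∈ K := by
  induction hx using Submodule.span_induction with
  | zero => simp
  | add x x' _ _ h h' => rw [add_lie]; exact K.add_mem h h'
  | smul c x _ h => rw [smul_lie]; exact K.smul_mem c h
  | mem x hx =>
    induction hy using Submodule.span_induction with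
    | zero => simp
    | add y y' _ _ h h' => rw [lie_add]; exact K.add_mem h h'
    | smul c y _ h => rw [lie_smul]; exact K.smul_mem c h
    | mem y hy => exact h x hx y hy

theorem lie_Dp_mem (s t : Tree) : ⁅Dp s, Dp t⁆ ∈ Submodule.span ℂ (Set.range Dp) := by
  change ⁅basis _, basis _⁆ ∈ _
  rw [lie_basis]
  refine finsum_induction (p := (· ∈ Submodule.span ℂ (Set.range Dp)))
    (Submodule.zero_mem _) (fun _ _ h h' => Submodule.add_mem _ h h')
    fun r => Submodule.smul_mem _ _ (Submodule.subset_span ⟨r, rfl⟩)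

/-- The subalgebra `𝔥 = ℂ d`. -/
noncomputable def 𝔥 : LieSubalgebra ℂ Alg :=
  { Submodule.span ℂ {d} with
    lie_mem' := fun hx hy => lie_mem_of_span (K := Submodule.span ℂ {d})
      (by rintro a rfl b rfl; rw [lie_self]; exact Submodule.zero_mem _) hx hy }

/-- The subalgebra `𝔫⁺` spanned by the `D_t^+`. -/
noncomputable def 𝔫plus : LieSubalgebra ℂ Alg :=
  { Submodule.span ℂ (Set.range Dp) with
    lie_mem' := fun hx hy => lie_mem_of_span (K := Submodule.span ℂ (Set.range Dp))
      (by rintro _ ⟨s, rfl⟩ _ ⟨t, rfl⟩; exact lie_Dp_mem s t) hx hy }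

theorem lie_mem_𝔫plus {x y : Alg} (hx : x ∈ 𝔥.toSubmodule ⊔ 𝔫plus.toSubmodule)
    (hy : y ∈ 𝔥.toSubmodule ⊔ 𝔫plus.toSubmodule) : ⁅x, y⁆ ∈ 𝔫plus.toSubmodule := by
  change x ∈ Submodule.span ℂ {d} ⊔ Submodule.span ℂ (Set.range Dp) at hx
  change y ∈ Submodule.span ℂ {d} ⊔ Submodule.span ℂ (Set.range Dp) at hy
  rw [← Submodule.span_union] at hx hy
  refine lie_mem_of_span ?_ hx hy
  have h1 : ∀ t, ⁅d, Dp t⁆ ∈ 𝔫plus.toSubmodule := fun t => by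
    have : ⁅d, Dp t⁆ = (t.order : ℂ) • Dp t := lie_basis _ _
    rw [this]
    exact Submodule.smul_mem _ _ (Submodule.subset_span ⟨t, rfl⟩)
  rintro _ (rfl | ⟨s, rfl⟩) _ (rfl | ⟨t, rfl⟩)
  · rw [lie_self]; exact Submodule.zero_mem _
  · exact h1 t
  · rw [← lie_skew]; exact Submodule.neg_mem _ (h1 s)
  · exact lie_Dp_mem s t

/-- The subalgebra `𝔥 ⊕ 𝔫⁺`. -/
noncomputable def 𝔟 : LieSubalgebra ℂ Alg :=
  { 𝔥.toSubmodule ⊔ 𝔫plus.toSubmodule with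
    lie_mem' := fun hx hy =>
      Submodule.mem_sup_right (S := 𝔥.toSubmodule) (lie_mem_𝔫plus hx hy) }

/-- The projection of `𝔤` onto `𝔥` along the span of all `D_t^+` and `D_t^-`. -/
noncomputable def toCartan : Alg →ₗ[ℂ] 𝔥 :=
  (basis.coord .d).smulRight ⟨d, Submodule.mem_span_singleton_self d⟩

theorem toCartan_add {h n : Alg} (hh : h ∈ 𝔥) (hn : n ∈ 𝔫plus) : toCartan (h + n) = ⟨h, hh⟩ := by
  have h1 : toCartan n = 0 := by
    have : 𝔫plus.toSubmodule ≤ LinearMap.ker toCartan := by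
      refine Submodule.span_le.2 ?_
      rintro _ ⟨t, rfl⟩
      change toCartan (basis (.plus t)) = 0
      simp [toCartan]
    exact this hn
  obtain ⟨c, rfl⟩ := Submodule.mem_span_singleton.1 hh
  rw [map_add, h1, add_zero, map_smul]
  ext1
  change c • (basis.repr (basis .d) .d • d) = c • d
  simp

/-- The character `h + n ↦ μ(h)` of `𝔥 ⊕ 𝔫⁺`. -/
noncomputable def weightChar (μ : Module.Dual ℂ 𝔥) : LieAlgebra.LieCharacter ℂ 𝔟 :=
  { (μ.comp toCartan).comp 𝔟.toSubmodule.subtype with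
    map_lie' := by
      rintro ⟨x, hx⟩ ⟨y, hy⟩
      have h : toCartan ⁅x, y⁆ = 0 := by
        have := toCartan_add 𝔥.zero_mem (lie_mem_𝔫plus hx hy)
        rwa [zero_add] at this
      change μ (toCartan ⁅x, y⁆) = _
      rw [h, map_zero]
      rw [LieRing.of_associative_ring_bracket, mul_comm, sub_self] }

theorem weightChar_apply (μ : Module.Dual ℂ 𝔥) {h n : Alg} (hh : h ∈ 𝔥) (hn : n ∈ 𝔫plus) :
    weightChar μ ⟨h + n, Submodule.add_mem_sup hh hn⟩ = μ ⟨h, hh⟩ :=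
  congrArg μ (toCartan_add hh hn)

/-- The one-dimensional module on which a Lie algebra `L` acts by the character `χ`, as a module
over the enveloping algebra. -/
def OneDim {L : Type*} [LieRing L] [LieAlgebra ℂ L] (_ : LieAlgebra.LieCharacter ℂ L) : Type := ℂ

section OneDim

variable {L : Type*} [LieRing L] [LieAlgebra ℂ L] (χ : LieAlgebra.LieCharacter ℂ L)

noncomputable instance : AddCommGroup (OneDim χ) := inferInstanceAs (AddCommGroup ℂ)

noncomputable instance : Module ℂ (OneDim χ) := inferInstanceAs (Module ℂ ℂ)

noncomputable instance : Module (UniversalEnvelopingAlgebra ℂ L) (OneDim χ) :=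
  Module.compHom ℂ (UniversalEnvelopingAlgebra.lift ℂ χ).toRingHom

end OneDim

/-- The tensor product `A ⊗_B V` of the right `B`-module `A` (via `φ : B → A`) and the left
`B`-module `V`, as a left `A`-module: the quotient of `A ⊗_ℂ V` by the relations
`a φ(b) ⊗ v = a ⊗ b v`. -/
abbrev BalancedTensor {A B : Type*} [Ring A] [Algebra ℂ A] [Ring B] [Algebra ℂ B] (φ : B →ₐ[ℂ] A)
    (V : Type*) [AddCommGroup V] [Module ℂ V] [Module B V] :=
  (A ⊗[ℂ] V) ⧸ Submodule.span A
    {x : A ⊗[ℂ] V | ∃ (a : A) (b : B) (v : V), x = (a * φ b) ⊗ₜ[ℂ] v - a ⊗ₜ[ℂ] (b • v)}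

/-- The algebra homomorphism `U(K) → U(L)` induced by a subalgebra `K` of `L`. -/
noncomputable def envelopingMap {L : Type*} [LieRing L] [LieAlgebra ℂ L] (K : LieSubalgebra ℂ L) :
    UniversalEnvelopingAlgebra ℂ K →ₐ[ℂ] UniversalEnvelopingAlgebra ℂ L :=
  UniversalEnvelopingAlgebra.lift ℂ ((UniversalEnvelopingAlgebra.ι ℂ).comp K.incl)

/-- The Verma module `M(μ) = U(𝔤) ⊗_{U(𝔥 ⊕ 𝔫⁺)} ℂ_μ`. -/
abbrev Verma (μ : Module.Dual ℂ 𝔥) :=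
  BalancedTensor (envelopingMap 𝔟) (OneDim (weightChar μ))

/-- The `U(L)`-module `V` admits the central character `χ : Z(L) → ℂ`, where `Z(L)` is the center
of `U(L)`: every `z ∈ Z(L)` acts on `V` as multiplication by `χ(z)`. -/
def AdmitsCentralCharacter {L : Type*} [LieRing L] [LieAlgebra ℂ L] (V : Type*) [AddCommGroup V]
    [Module ℂ V] [Module (UniversalEnvelopingAlgebra ℂ L) V]
    (χ : Subalgebra.center ℂ (UniversalEnvelopingAlgebra ℂ L) →ₐ[ℂ] ℂ) : Prop :=
  ∀ (z : Subalgebra.center ℂ (UniversalEnvelopingAlgebra ℂ L)) (v : V),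
    (z : UniversalEnvelopingAlgebra ℂ L) • v = χ z • v

end InsElim

/-! The center of $U(\mathfrak{g})$ consists of scalars only (`center_enveloping_eq_bot`). A scalar
acts on every module in the same way, so the augmentation $U(\mathfrak{g})\to\mathbb{C}$, restricted
to the center, is a central character of every Verma module, whatever $\mu$ is.

Triviality of the center follows from a criterion for any Lie algebra $L$ with a faithful
representation $\rho:L\to A$ in characteristic zero (`center_eq_bot`). Every functional $\psi$ on
$L$ has the form $\varphi\circ\rho$ with $\varphi(1)=0$. The coaction $x\mapsto\rho(x)\otimes
1+1\otimes x$, contracted with $\varphi$, is then an operator $\partial_\psi$ on $U(L)$ that lowers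
degree and acts as a derivation modulo lower terms. The representation thus provides partial
derivatives without the Poincaré-Birkhoff-Witt theorem. Let $z$ be central of degree at most $m+1$,
written with a finite set $S$ of basis elements. If $\psi$ vanishes on $S$, then $\partial_\psi z$
has degree at most $m-1$. Applying $\partial_\psi$ to $[y,z]=0$ shows that
$\partial_{\psi\circ\mathrm{ad}\,y}z$ is as small. If every coordinate function on the span of $S$
arises as $\psi\circ\mathrm{ad}\,y$, then Euler's formula $\sum_a x_a\partial_a z\equiv(m+1)z$ puts
$z$ in degree at most $m$, and descent ends at the scalars.

For trees, $y=D_s^-$ and $\psi$ is a multiple of the coordinate of $D_q^-$, where $s$ and $q$ are a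
long path or a long path with a tree $t$ grafted at its root. The coordinate vanishes on $S$ because
$q$ is too large, and the bracket detects a single basis element because $t$ can be recovered from
the grafted path (`eq_of_α_pathGraft`, `exists_separating_bracket`). -/

namespace EnvelopingCenter

attribute [local instance] LieRing.ofAssociativeRing

open scoped TensorProduct
open UniversalEnvelopingAlgebra (ι)

variable {K L : Type*} [Field K] [LieRing L] [LieAlgebra K L]

/-! ### The standard filtration of an enveloping algebra. -/

section Filtration

/-- The subspace `K + F` of the enveloping algebra, for a subspace `F` of the Lie algebra. -/
noncomputable def affineSpan (F : Submodule K L) : Submodule K (UniversalEnvelopingAlgebra K L) :=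
  1 ⊔ F.map ((ι K : L →ₗ⁅K⁆ UniversalEnvelopingAlgebra K L) :
    L →ₗ[K] UniversalEnvelopingAlgebra K L)

theorem one_le_affineSpan (F : Submodule K L) : 1 ≤ affineSpan F := le_sup_left

theorem ι_mem_affineSpan {F : Submodule K L} {x : L} (hx : x ∈ F) : ι K x ∈ affineSpan F :=
  Submodule.mem_sup_right ⟨x, hx, rfl⟩

theorem affineSpan_mono {F G : Submodule K L} (h : F ≤ G) : affineSpan F ≤ affineSpan G :=
  sup_le_sup_left (Submodule.map_mono h) _

theorem affineSpan_pow_mono (F : Submodule K L) {m n : ℕ} (h : m ≤ n) :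
    affineSpan F ^ m ≤ affineSpan F ^ n := by
  induction h with
  | refl => exact le_rfl
  | step _ ih =>
    refine ih.trans ?_
    rw [pow_succ]
    calc _ = _ * 1 := (mul_one _).symm
      _ ≤ _ := mul_le_mul_right (one_le_affineSpan F) _

/-- An induction principle for the powers of `K + F`. -/
theorem affineSpan_pow_induction (F : Submodule K L)
    {p : ℕ → UniversalEnvelopingAlgebra K L → Prop}
    (one : p 0 1) (add : ∀ m u v, p m u → p m v → p m (u + v))
    (smul : ∀ m (c : K) u, p m u → p m (c • u))
    (lift : ∀ m u, u ∈ affineSpan F ^ m → p m u → p (m + 1) u)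
    (mul : ∀ m u, ∀ x ∈ F, u ∈ affineSpan F ^ m → p m u → p (m + 1) (ι K x * u)) :
    ∀ m, ∀ u ∈ affineSpan F ^ m, p m u := by
  intro m
  induction m with
  | zero =>
    intro u hu
    rw [pow_zero, Submodule.mem_one] at hu
    obtain ⟨c, rfl⟩ := hu
    rw [Algebra.algebraMap_eq_smul_one]
    exact smul 0 c 1 one
  | succ m ih =>
    intro u hu
    rw [pow_succ'] at hu
    refine Submodule.mul_induction_on hu ?_ fun x y => add _ x y
    intro b hb v hv
    obtain ⟨b₀, hb₀, b₁, ⟨x, hx, rfl⟩, rfl⟩ := Submodule.mem_sup.1 hb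
    obtain ⟨c, rfl⟩ := Submodule.mem_one.1 hb₀
    rw [add_mul, ← Algebra.smul_def]
    exact add _ _ _ (smul _ _ _ (lift _ _ hv (ih v hv))) (mul _ _ x hx hv (ih v hv))

variable (K L) in
/-- The standard filtration of the enveloping algebra, shifted by one: `filtration (m + 1)` is
spanned by the products of at most `m` elements of the Lie algebra, and `filtration 0 = 0`. -/
noncomputable def filtration : ℕ → Submodule K (UniversalEnvelopingAlgebra K L)
  | 0 => ⊥
  | m + 1 => affineSpan (⊤ : Submodule K L) ^ m

theorem filtration_succ_le (m : ℕ) : filtration K L m ≤ filtration K L (m + 1) := by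
  cases m with
  | zero => exact bot_le
  | succ m => exact affineSpan_pow_mono _ m.le_succ

theorem affineSpan_pow_le_filtration (F : Submodule K L) (m : ℕ) :
    affineSpan F ^ m ≤ filtration K L (m + 1) :=
  pow_le_pow_left' (affineSpan_mono le_top) m

theorem ι_mul_mem (x : L) {m : ℕ} {u : UniversalEnvelopingAlgebra K L}
    (hu : u ∈ filtration K L m) : ι K x * u ∈ filtration K L (m + 1) := by
  cases m with
  | zero =>
    rw [(Submodule.mem_bot K).1 hu, mul_zero]
    exact Submodule.zero_mem _
  | succ m =>
    change _ ∈ affineSpan ⊤ ^ (m + 1)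
    rw [pow_succ']
    exact Submodule.mul_mem_mul (ι_mem_affineSpan trivial) hu

theorem ι_lie (x y : L) : ι K ⁅x, y⁆ = ι K x * ι K y - ι K y * ι K x := by
  rw [LieHom.map_lie, LieRing.of_associative_ring_bracket]

/-- The commutator with $y$ is a derivation that maps $L$ to $L$, so in a product it replaces one
factor at a time and never adds one. -/
theorem commutator_mem (y : L) {m : ℕ} {u : UniversalEnvelopingAlgebra K L}
    (hu : u ∈ filtration K L m) : ι K y * u - u * ι K y ∈ filtration K L m := by
  cases m with
  | zero =>
    rw [(Submodule.mem_bot K).1 hu, mul_zero, zero_mul, sub_zero]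
    exact Submodule.zero_mem _
  | succ m =>
    refine affineSpan_pow_induction (⊤ : Submodule K L)
      (p := fun m u => ι K y * u - u * ι K y ∈ filtration K L (m + 1)) ?_ ?_ ?_ ?_ ?_ m u hu
    · simp
    · intro m u v h h'
      rw [mul_add, add_mul, add_sub_add_comm]
      exact Submodule.add_mem _ h h'
    · intro m c u h
      rw [mul_smul_comm, smul_mul_assoc, ← smul_sub]
      exact Submodule.smul_mem _ c h
    · exact fun m u _ h => filtration_succ_le _ h
    · intro m u x _ hu h
      have : ι K y * (ι K x * u) - ι K x * u * ι K y
          = ι K ⁅y, x⁆ * u + ι K x * (ι K y * u - u * ι K y) := by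
        rw [ι_lie]; noncomm_ring
      rw [this]
      exact Submodule.add_mem _ (ι_mul_mem _ hu) (ι_mul_mem _ h)

/-- The elements of finite degree form a subalgebra $S$ containing $L$. The inclusion of $L$ extends
to $U(L)\to S$, and by the uniqueness part of the universal property its composite with $S\subseteq
U(L)$ is the identity. -/
theorem exists_mem_affineSpan_pow (u : UniversalEnvelopingAlgebra K L) :
    ∃ m, u ∈ affineSpan (⊤ : Submodule K L) ^ m := by
  let S : Subalgebra K (UniversalEnvelopingAlgebra K L) :=
    { carrier := {u | ∃ m, u ∈ affineSpan (⊤ : Submodule K L) ^ m}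
      mul_mem' := by
        rintro u v ⟨m, hm⟩ ⟨n, hn⟩
        exact ⟨m + n, by rw [pow_add]; exact Submodule.mul_mem_mul hm hn⟩
      add_mem' := by
        rintro u v ⟨m, hm⟩ ⟨n, hn⟩
        exact ⟨max m n, Submodule.add_mem _ (affineSpan_pow_mono _ (le_max_left m n) hm)
          (affineSpan_pow_mono _ (le_max_right m n) hn)⟩
      algebraMap_mem' := fun c => ⟨0, by
        rw [pow_zero]; exact Submodule.algebraMap_mem c⟩ }
  have hι : ∀ x : L, ι K x ∈ S := fun x => ⟨1, by
    rw [pow_one]; exact ι_mem_affineSpan trivial⟩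
  let f : L →ₗ⁅K⁆ S :=
    { toFun := fun x => ⟨ι K x, hι x⟩
      map_add' := fun x y => Subtype.ext (map_add _ x y)
      map_smul' := fun c x => Subtype.ext (map_smul _ c x)
      map_lie' := fun {x y} => Subtype.ext (LieHom.map_lie _ x y) }
  have h : S.val.comp (UniversalEnvelopingAlgebra.lift K f) = AlgHom.id K _ := by
    apply UniversalEnvelopingAlgebra.hom_ext
    ext x
    change ((UniversalEnvelopingAlgebra.lift K f (ι K x) : S) : UniversalEnvelopingAlgebra K L)
      = ι K x
    rw [UniversalEnvelopingAlgebra.lift_ι_apply]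
    rfl
  have h' := congrArg (fun g => g u) h
  change ((UniversalEnvelopingAlgebra.lift K f u : S) : UniversalEnvelopingAlgebra K L) = u at h'
  rw [← h']
  exact (UniversalEnvelopingAlgebra.lift K f u).2

/-- An element of filtration degree `m` involves only finitely many basis elements. -/
theorem exists_finset_mem_affineSpan_pow {B : Type*} (b : Module.Basis B K L) (m : ℕ)
    (u : UniversalEnvelopingAlgebra K L) (hu : u ∈ affineSpan (⊤ : Submodule K L) ^ m) :
    ∃ S : Finset B, u ∈ affineSpan (Submodule.span K (b '' S)) ^ m := by
  classical
  have mono : ∀ {S T : Finset B}, S ⊆ T → ∀ m, affineSpan (Submodule.span K (b '' S)) ^ m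
      ≤ affineSpan (Submodule.span K (b '' T)) ^ m := fun h m =>
    pow_le_pow_left' (affineSpan_mono (Submodule.span_mono (Set.image_mono
      (Finset.coe_subset.2 h)))) m
  refine affineSpan_pow_induction (⊤ : Submodule K L)
    (p := fun m u => ∃ S : Finset B, u ∈ affineSpan (Submodule.span K (b '' S)) ^ m)
    ?_ ?_ ?_ ?_ ?_ m u hu
  · exact ⟨∅, by rw [pow_zero]; exact Submodule.one_le.1 le_rfl⟩
  · rintro m u v ⟨S, hS⟩ ⟨T, hT⟩
    exact ⟨S ∪ T, Submodule.add_mem _ (mono Finset.subset_union_left m hS)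
      (mono Finset.subset_union_right m hT)⟩
  · rintro m c u ⟨S, hS⟩
    exact ⟨S, Submodule.smul_mem _ c hS⟩
  · rintro m u - ⟨S, hS⟩
    exact ⟨S, affineSpan_pow_mono _ m.le_succ hS⟩
  · rintro m u x - - ⟨S, hS⟩
    refine ⟨(b.repr x).support ∪ S, ?_⟩
    rw [pow_succ']
    refine Submodule.mul_mem_mul (ι_mem_affineSpan ?_) (mono Finset.subset_union_right m hS)
    refine Submodule.span_mono (Set.image_mono (Finset.coe_subset.2 Finset.subset_union_left)) ?_
    exact b.mem_span_repr_support x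

end Filtration

/-! ### Partial derivatives on the enveloping algebra, obtained from a representation. -/

section Derivative

variable {A : Type*} [Ring A] [Algebra K A] (ρ : L →ₗ⁅K⁆ A)

/-- The algebra homomorphism `U(L) → A ⊗ U(L)` with `x ↦ ρ(x) ⊗ 1 + 1 ⊗ x`. -/
noncomputable def coaction :
    UniversalEnvelopingAlgebra K L →ₐ[K] A ⊗[K] UniversalEnvelopingAlgebra K L :=
  UniversalEnvelopingAlgebra.lift K
    { toFun := fun x => ρ x ⊗ₜ 1 + 1 ⊗ₜ ι K x
      map_add' := fun x y => by
        rw [map_add, map_add, TensorProduct.add_tmul, TensorProduct.tmul_add]; abel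
      map_smul' := fun c x => by
        rw [map_smul, map_smul, ← TensorProduct.smul_tmul', TensorProduct.tmul_smul, ← smul_add]
        rfl
      map_lie' := fun {x y} => by
        rw [LieHom.map_lie, LieHom.map_lie]
        simp only [LieRing.of_associative_ring_bracket, mul_add, add_mul,
          Algebra.TensorProduct.tmul_mul_tmul, one_mul, mul_one, TensorProduct.sub_tmul,
          TensorProduct.tmul_sub]
        abel }

theorem coaction_ι (x : L) : coaction ρ (ι K x) = ρ x ⊗ₜ 1 + 1 ⊗ₜ ι K x :=
  UniversalEnvelopingAlgebra.lift_ι_apply _ _ _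

/-- Contraction of the first factor of `A ⊗ U` with a linear functional. -/
noncomputable def contract {U : Type*} [Ring U] [Algebra K U] (φ : Module.Dual K A) :
    A ⊗[K] U →ₗ[K] U :=
  (TensorProduct.lid K U).toLinearMap.comp (LinearMap.rTensor U φ)

theorem contract_tmul {U : Type*} [Ring U] [Algebra K U] (φ : Module.Dual K A) (a : A) (u : U) :
    contract φ (a ⊗ₜ[K] u) = φ a • u := by
  simp [contract]

theorem contract_left_mul {U : Type*} [Ring U] [Algebra K U] (φ : Module.Dual K A) (a : A)
    (u : U) (w : A ⊗[K] U) :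
    contract φ ((a ⊗ₜ u) * w) = u * contract (φ.comp (LinearMap.mulLeft K a)) w := by
  induction w with
  | zero => simp
  | add w w' h h' => rw [mul_add, map_add, map_add, mul_add, h, h']
  | tmul a' u' => simp [contract_tmul]

theorem contract_mul_right {U : Type*} [Ring U] [Algebra K U] (φ : Module.Dual K A) (a : A)
    (u : U) (w : A ⊗[K] U) :
    contract φ (w * (a ⊗ₜ u)) = contract (φ.comp (LinearMap.mulRight K a)) w * u := by
  induction w with
  | zero => simp
  | add w w' h h' => rw [add_mul, map_add, map_add, add_mul, h, h']
  | tmul a' u' => simp [contract_tmul]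

/-- The operator `(φ ⊗ id) ∘ coaction` on the enveloping algebra. If `φ(1) = 0`, it induces on the
associated graded algebra the derivation that extends the functional `φ ∘ ρ`. -/
noncomputable def pderiv (φ : Module.Dual K A) :
    UniversalEnvelopingAlgebra K L →ₗ[K] UniversalEnvelopingAlgebra K L :=
  (contract φ).comp (coaction ρ).toLinearMap

theorem pderiv_one (φ : Module.Dual K A) : pderiv ρ φ 1 = φ 1 • 1 := by
  change contract φ (coaction ρ 1) = _
  rw [map_one, Algebra.TensorProduct.one_def, contract_tmul]

/-- A Leibniz rule up to lower terms: the twisted functional $\varphi(\rho(x)\,\cdot)$ takes the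
value $\varphi(\rho(x))$ at $1$, so the first summand is $\varphi(\rho(x))u$ plus terms of smaller
degree. Since the functional changes, inductions on degree have to quantify over all $\varphi$. -/
theorem pderiv_ι_mul (φ : Module.Dual K A) (x : L) (u : UniversalEnvelopingAlgebra K L) :
    pderiv ρ φ (ι K x * u)
      = pderiv ρ (φ.comp (LinearMap.mulLeft K (ρ x))) u + ι K x * pderiv ρ φ u := by
  change contract φ (coaction ρ _) = _
  rw [map_mul, coaction_ι, add_mul, map_add, contract_left_mul, contract_left_mul, one_mul,
    LinearMap.mulLeft_one, LinearMap.comp_id]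
  rfl

theorem pderiv_mul_ι (φ : Module.Dual K A) (x : L) (u : UniversalEnvelopingAlgebra K L) :
    pderiv ρ φ (u * ι K x)
      = pderiv ρ (φ.comp (LinearMap.mulRight K (ρ x))) u + pderiv ρ φ u * ι K x := by
  change contract φ (coaction ρ _) = _
  rw [map_mul, coaction_ι, mul_add, map_add, contract_mul_right, contract_mul_right, mul_one,
    LinearMap.mulRight_one, LinearMap.comp_id]
  rfl

theorem pderiv_sub (φ φ' : Module.Dual K A) (u : UniversalEnvelopingAlgebra K L) :
    pderiv ρ (φ - φ') u = pderiv ρ φ u - pderiv ρ φ' u := by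
  simp [pderiv, contract, LinearMap.rTensor_sub]

/-- The new functional is $a\mapsto\varphi([\rho(y),a])$. It kills $1$ and restricts to
$x\mapsto\varphi(\rho([y,x]))$ on $L$; this is how differentiation along $\psi\circ\mathrm{ad}\,y$
is obtained from differentiation along $\psi$. -/
theorem pderiv_commutator (φ : Module.Dual K A) (y : L) (u : UniversalEnvelopingAlgebra K L) :
    pderiv ρ φ (ι K y * u - u * ι K y)
      = pderiv ρ (φ.comp (LinearMap.mulLeft K (ρ y) - LinearMap.mulRight K (ρ y))) u
        + (ι K y * pderiv ρ φ u - pderiv ρ φ u * ι K y) := by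
  rw [map_sub, pderiv_ι_mul, pderiv_mul_ι, LinearMap.comp_sub, pderiv_sub]
  abel

/-- The coaction sends $u$ to $1\otimes u$ plus terms whose second factor has smaller degree. -/
theorem pderiv_sub_mem (m : ℕ) (u : UniversalEnvelopingAlgebra K L)
    (hu : u ∈ filtration K L (m + 1)) (φ : Module.Dual K A) :
    pderiv ρ φ u - φ 1 • u ∈ filtration K L m := by
  refine affineSpan_pow_induction (⊤ : Submodule K L)
    (p := fun m u => ∀ φ, pderiv ρ φ u - φ 1 • u ∈ filtration K L m) ?_ ?_ ?_ ?_ ?_ m u hu φ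
  · intro φ
    rw [pderiv_one, sub_self]
    exact Submodule.zero_mem _
  · intro m u v h h' φ
    rw [map_add, smul_add, add_sub_add_comm]
    exact Submodule.add_mem _ (h φ) (h' φ)
  · intro m c u h φ
    rw [map_smul, smul_comm, ← smul_sub]
    exact Submodule.smul_mem _ c (h φ)
  · exact fun m u _ h φ => filtration_succ_le _ (h φ)
  · intro m u x _ hu h φ
    rw [pderiv_ι_mul, ← mul_smul_comm, add_sub_assoc, ← mul_sub]
    refine Submodule.add_mem _ ?_ (ι_mul_mem _ (h φ))
    -- The twisted functional need not kill $1$, so its contraction of $u$ is only known to keep the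
    -- degree of $u$. This is enough, as $\iota(x)u$ is allowed one degree more.
    have h1 := Submodule.add_mem _ (filtration_succ_le _ (h (φ.comp (LinearMap.mulLeft K (ρ x)))))
      (Submodule.smul_mem _ ((φ.comp (LinearMap.mulLeft K (ρ x))) 1) hu)
    rwa [sub_add_cancel] at h1

theorem pderiv_mem {m : ℕ} {u : UniversalEnvelopingAlgebra K L}
    (hu : u ∈ filtration K L (m + 1)) {φ : Module.Dual K A} (hφ : φ 1 = 0) :
    pderiv ρ φ u ∈ filtration K L m := by
  have := pderiv_sub_mem ρ m u hu φ
  rwa [hφ, zero_smul, sub_zero] at this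

/-- The degree drops by two: `affineSpan F ^ m` lies in `filtration (m + 1)`. The leading part of
the operator is a derivation that kills $F$, hence kills products of elements of $F$ modulo lower
terms. For $m=0$ the truncated subtraction gives the zero subspace. -/
theorem pderiv_mem_of_vanish (F : Submodule K L) (φ : Module.Dual K A) (hφ : φ 1 = 0)
    (hF : ∀ x ∈ F, φ (ρ x) = 0) (m : ℕ) (u : UniversalEnvelopingAlgebra K L)
    (hu : u ∈ affineSpan F ^ m) : pderiv ρ φ u ∈ filtration K L (m - 1) := by
  refine affineSpan_pow_induction F
    (p := fun m u => pderiv ρ φ u ∈ filtration K L (m - 1)) ?_ ?_ ?_ ?_ ?_ m u hu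
  · rw [pderiv_one, hφ, zero_smul]
    exact Submodule.zero_mem _
  · intro m u v h h'
    rw [map_add]
    exact Submodule.add_mem _ h h'
  · intro m c u h
    rw [map_smul]
    exact Submodule.smul_mem _ c h
  · intro m u _ h
    cases m with
    | zero => exact h
    | succ m => exact filtration_succ_le _ h
  · intro m u x hx hu h
    rw [pderiv_ι_mul]
    -- For $x\in F$ the twisted functional takes the value $\varphi(\rho(x))=0$ at $1$, so it lowers
    -- the degree as well.
    refine Submodule.add_mem _ (pderiv_mem ρ (affineSpan_pow_le_filtration F m hu) ?_) ?_
    · change φ (ρ x * 1) = 0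
      rw [mul_one, hF x hx]
    · cases m with
      | zero =>
        rw [(Submodule.mem_bot K).1 h, mul_zero]
        exact Submodule.zero_mem _
      | succ m => exact ι_mul_mem x h

/-- Euler's formula on the associated graded algebra. -/
theorem euler_mem {B : Type*} [DecidableEq B] (S : Finset B) (x : B → L) (φ : B → Module.Dual K A)
    (h1 : ∀ a ∈ S, φ a 1 = 0)
    (hφ : ∀ a ∈ S, ∀ b ∈ S, φ a (ρ (x b)) = if a = b then 1 else 0) (m : ℕ)
    (u : UniversalEnvelopingAlgebra K L) (hu : u ∈ affineSpan (Submodule.span K (x '' S)) ^ m) :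
    ∑ a ∈ S, ι K (x a) * pderiv ρ (φ a) u - (m : K) • u ∈ filtration K L m := by
  have dual : ∀ y ∈ Submodule.span K (x '' S), ∑ a ∈ S, φ a (ρ y) • x a = y := by
    intro y hy
    induction hy using Submodule.span_induction with
    | zero => simp
    | add y y' _ _ h h' => simp only [map_add, add_smul, Finset.sum_add_distrib, h, h']
    | smul c y _ h =>
      conv_rhs => rw [← h, Finset.smul_sum]
      simp only [map_smul, smul_eq_mul, mul_smul]
    | mem y hy =>
      obtain ⟨b, hb, rfl⟩ := hy
      rw [Finset.sum_congr rfl fun a ha => by rw [hφ a ha b hb]]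
      simp only [ite_smul, one_smul, zero_smul, Finset.sum_ite_eq', if_pos (Finset.mem_coe.1 hb)]
  refine affineSpan_pow_induction (Submodule.span K (x '' S)) (p := fun m u =>
    ∑ a ∈ S, ι K (x a) * pderiv ρ (φ a) u - (m : K) • u ∈ filtration K L m) ?_ ?_ ?_ ?_ ?_ m u hu
  · rw [Finset.sum_eq_zero fun a ha => by rw [pderiv_one, h1 a ha, zero_smul, mul_zero],
      Nat.cast_zero, zero_smul, sub_zero]
    exact Submodule.zero_mem _
  · intro m u v h h'
    simp only [map_add, mul_add, Finset.sum_add_distrib, smul_add]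
    rw [add_sub_add_comm]
    exact Submodule.add_mem _ h h'
  · intro m c u h
    simp only [map_smul, mul_smul_comm]
    rw [← Finset.smul_sum, smul_comm, ← smul_sub]
    exact Submodule.smul_mem _ c h
  · intro m u hu h
    -- Regarding $u$ as an element of degree $m+1$ changes the Euler factor by one copy of $u$,
    -- which now counts as a lower term.
    have : ∑ a ∈ S, ι K (x a) * pderiv ρ (φ a) u - ((m + 1 : ℕ) : K) • u
        = (∑ a ∈ S, ι K (x a) * pderiv ρ (φ a) u - (m : K) • u) - u := by
      push_cast
      rw [add_smul, one_smul]
      abel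
    rw [this]
    exact Submodule.sub_mem _ (filtration_succ_le _ h) (affineSpan_pow_le_filtration _ m hu)
  · intro m u y hy hu h
    have hu' := affineSpan_pow_le_filtration _ m hu
    -- The extra copy of $yu$ is the sum of the leading parts $\varphi_a(\rho(y))\,x_a u$. What
    -- remains is the Euler defect of $u$ multiplied by $y$, the lower terms of the twisted
    -- functionals, and the commutators from moving $x_a$ past $y$.
    have key : ∑ a ∈ S, ι K (x a) * pderiv ρ (φ a) (ι K y * u) - ((m + 1 : ℕ) : K) • (ι K y * u)
        = ∑ a ∈ S, (ι K (x a) * (pderiv ρ ((φ a).comp (LinearMap.mulLeft K (ρ y))) u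
            - φ a (ρ y) • u) + ι K ⁅x a, y⁆ * pderiv ρ (φ a) u)
          + ι K y * (∑ a ∈ S, ι K (x a) * pderiv ρ (φ a) u - (m : K) • u) := by
      have e1 : ι K y * u = ∑ a ∈ S, ι K (x a) * (φ a (ρ y) • u) := by
        conv_lhs => rw [← dual y hy, map_sum, Finset.sum_mul]
        simp only [map_smul, smul_mul_assoc, mul_smul_comm]
      have e2 : ∑ a ∈ S, ι K (x a) * pderiv ρ (φ a) (ι K y * u)
          = ∑ a ∈ S, (ι K (x a) * (pderiv ρ ((φ a).comp (LinearMap.mulLeft K (ρ y))) u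
              - φ a (ρ y) • u) + ι K ⁅x a, y⁆ * pderiv ρ (φ a) u)
            + ∑ a ∈ S, ι K (x a) * (φ a (ρ y) • u)
            + ι K y * ∑ a ∈ S, ι K (x a) * pderiv ρ (φ a) u := by
        rw [Finset.mul_sum, ← Finset.sum_add_distrib, ← Finset.sum_add_distrib]
        refine Finset.sum_congr rfl fun a _ => ?_
        rw [pderiv_ι_mul, ι_lie]
        noncomm_ring
      rw [e2, ← e1, mul_sub, mul_smul_comm]
      push_cast
      rw [add_smul, one_smul]
      abel
    rw [key]
    refine Submodule.add_mem _ (Submodule.sum_mem _ fun a ha => Submodule.add_mem _ ?_ ?_)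
      (ι_mul_mem _ h)
    · have := pderiv_sub_mem ρ m u hu' ((φ a).comp (LinearMap.mulLeft K (ρ y)))
      rw [LinearMap.comp_apply, LinearMap.mulLeft_apply, mul_one] at this
      exact ι_mul_mem _ this
    · exact ι_mul_mem _ (pderiv_mem ρ hu' (h1 a ha))

end Derivative

/-! ### The criterion for a trivial center. -/

/-- The center of the enveloping algebra of `L` is trivial if, on every finite set of basis elements
of `L`, each coordinate function has the form `x ↦ ψ ⁅y, x⁆`, where `ψ` vanishes on the set. -/
theorem center_eq_bot [CharZero K] {A : Type*} [Ring A] [Algebra K A]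
    (ρ : L →ₗ⁅K⁆ A) (hρ : Function.Injective ρ) {B : Type*} [DecidableEq B]
    (b : Module.Basis B K L)
    (H : ∀ S : Finset B, ∀ a ∈ S, ∃ (y : L) (ψ : Module.Dual K L), (∀ c ∈ S, ψ (b c) = 0) ∧
      ∀ c ∈ S, ψ ⁅y, b c⁆ = if a = c then 1 else 0) :
    Subalgebra.center K (UniversalEnvelopingAlgebra K L) = ⊥ := by
  -- If $\rho(x)$ is a scalar, then $x$ is central in $L$ by faithfulness. The hypothesis `H` for
  -- the support of $x$ expresses each coordinate of $x$ as $\psi([y,x])=0$.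
  have scalar : ∀ (x : L) (c : K), ρ x = algebraMap K A c → x = 0 := by
    intro x c hx
    have hy : ∀ y : L, ⁅y, x⁆ = 0 := fun y => hρ (by
      rw [LieHom.map_lie, LieRing.of_associative_ring_bracket, hx, Algebra.commutes, sub_self,
        map_zero])
    refine b.repr.map_eq_zero_iff.1 (Finsupp.ext fun a => ?_)
    by_contra ha
    obtain ⟨y, ψ, -, h⟩ := H _ a (Finsupp.mem_support_iff.2 ha)
    have h2 : ψ ⁅y, x⁆ = b.repr x a := by
      conv_lhs => rw [← b.linearCombination_repr x, Finsupp.linearCombination_apply, Finsupp.sum,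
        lie_sum, map_sum]
      rw [Finset.sum_eq_single a]
      · rw [lie_smul, map_smul, h a (Finsupp.mem_support_iff.2 ha), if_pos rfl, smul_eq_mul,
          mul_one]
      · intro c hc hne
        rw [lie_smul, map_smul, h c hc, if_neg hne.symm, smul_zero]
      · intro h'
        rw [Finsupp.notMem_support_iff.1 h', zero_smul, lie_zero, map_zero]
    rw [hy, map_zero] at h2
    exact ha h2.symm
  -- By `scalar`, $L$ still embeds in $A/K1$, so $\psi$ can be extended from $L$ to $A$ with value
  -- $0$ at $1$.
  have ext : ∀ ψ : Module.Dual K L, ∃ φ : Module.Dual K A, φ 1 = 0 ∧ ∀ x, φ (ρ x) = ψ x := by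
    intro ψ
    let N : Submodule K A := Submodule.span K {1}
    let f : L →ₗ[K] A ⧸ N := N.mkQ.comp (ρ : L →ₗ[K] A)
    have hf : LinearMap.ker f = ⊥ := by
      refine LinearMap.ker_eq_bot'.2 fun x hx => ?_
      have h1 : ρ x ∈ N := (Submodule.Quotient.mk_eq_zero N).1 hx
      obtain ⟨c, hc⟩ := Submodule.mem_span_singleton.1 h1
      exact scalar x c (by rw [← hc, Algebra.algebraMap_eq_smul_one])
    obtain ⟨g, hg⟩ := f.exists_leftInverse_of_injective hf
    refine ⟨ψ.comp (g.comp N.mkQ), ?_, fun x => ?_⟩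
    · change ψ (g (N.mkQ 1)) = 0
      rw [Submodule.mkQ_apply,
        (Submodule.Quotient.mk_eq_zero N).2 (Submodule.mem_span_singleton_self 1), map_zero,
        map_zero]
    · exact congrArg ψ (congrArg (fun h => h x) hg)
  have descend : ∀ (m : ℕ) (z : UniversalEnvelopingAlgebra K L),
      z ∈ Subalgebra.center K (UniversalEnvelopingAlgebra K L) →
      z ∈ affineSpan (⊤ : Submodule K L) ^ (m + 1) → z ∈ affineSpan (⊤ : Submodule K L) ^ m := by
    intro m z hz hzm
    obtain ⟨S, hS⟩ := exists_finset_mem_affineSpan_pow b _ z hzm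
    choose! y ψ hψ hψ' using H S
    choose φ hφ1 hφ using ext
    -- On $\rho(L)$ this is $\psi_a\circ\mathrm{ad}\,y_a$, which is dual to the basis elements in
    -- $S$.
    let φ' : B → Module.Dual K A := fun a =>
      (φ (ψ a)).comp (LinearMap.mulLeft K (ρ (y a)) - LinearMap.mulRight K (ρ (y a)))
    have hφ'1 : ∀ a, φ' a 1 = 0 := fun a => by simp [φ']
    have hφ' : ∀ a ∈ S, ∀ c ∈ S, φ' a (ρ (b c)) = if a = c then 1 else 0 := by
      intro a ha c hc
      rw [← hψ' a ha c hc, ← hφ, LieHom.map_lie, LieRing.of_associative_ring_bracket]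
      rfl
    -- In the shifted indexing $z$ lies in `filtration (m + 2)`, so this is one step better than
    -- what `pderiv_mem` gives.
    have small : ∀ a ∈ S, pderiv ρ (φ' a) z ∈ filtration K L m := by
      intro a ha
      -- Differentiating $[y_a,z]=0$ expresses the derivative along $\psi_a\circ\mathrm{ad}\,y_a$ as
      -- minus the commutator of $y_a$ with the derivative along $\psi_a$. The latter derivative has
      -- dropped by two degrees, since $\psi_a$ vanishes on $S$.
      have h1 := pderiv_commutator ρ (φ (ψ a)) (y a) z
      rw [(Subalgebra.mem_center_iff.1 hz (ι K (y a))), sub_self, map_zero] at h1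
      have h2 : pderiv ρ (φ (ψ a)) z ∈ filtration K L m := by
        refine pderiv_mem_of_vanish ρ _ _ (hφ1 _) (fun x hx => ?_) _ z hS
        rw [hφ]
        have : Submodule.span K (b '' S) ≤ LinearMap.ker (ψ a) := by
          refine Submodule.span_le.2 ?_
          rintro _ ⟨c, hc, rfl⟩
          exact hψ a ha c hc
        exact this hx
      rw [eq_neg_of_add_eq_zero_left h1.symm]
      exact Submodule.neg_mem _ (commutator_mem _ h2)
    have h3 := euler_mem ρ S b φ' (fun a _ => hφ'1 a) hφ' _ z hS
    have h4 : ∑ a ∈ S, ι K (b a) * pderiv ρ (φ' a) z ∈ filtration K L (m + 1) :=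
      Submodule.sum_mem _ fun a ha => ι_mul_mem _ (small a ha)
    have h5 := Submodule.sub_mem _ h4 h3
    rw [sub_sub_cancel] at h5
    -- Characteristic zero is needed to divide by the Euler factor $m+1$.
    exact (Submodule.smul_mem_iff _ (Nat.cast_ne_zero.2 m.succ_ne_zero)).1 h5
  refine eq_bot_iff.2 fun z hz => ?_
  obtain ⟨m, hm⟩ := exists_mem_affineSpan_pow z
  have h0 : z ∈ affineSpan (⊤ : Submodule K L) ^ 0 := by
    induction m with
    | zero => exact hm
    | succ m ih => exact ih (descend m z hz hm)
  rw [pow_zero, Submodule.mem_one] at h0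
  exact Algebra.mem_bot.2 h0

end EnvelopingCenter
namespace InsElim

attribute [local instance] LieRing.ofAssociativeRing

/-! ### Grafting at the root of a long path -/

theorem β_ne_zero_iff {V S : Type} [PartialOrder V] [PartialOrder S] [Finite V] [Finite S]
    (hV : IsTreeOrder V) (hS : IsTreeOrder S) {r : Tree} :
    β r (cls S) (cls V) ≠ 0 ↔ ∃ v : V, cls (Graft V v S) = r := by
  rw [β_cls hV hS, Nat.card_ne_zero, nonempty_subtype]
  exact and_iff_left inferInstance

theorem α_ne_zero_iff {V : Type} [PartialOrder V] [Finite V] (hV : IsTreeOrder V) {t r : Tree} :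
    α t (cls V) r ≠ 0 ↔ ∃ v : V,
      (¬ IsBot v ∧ cls {w // v ≤ w} = t) ∧ cls {w // ¬ v ≤ w} = r := by
  rw [α_cls hV, Nat.card_ne_zero, nonempty_subtype]
  exact and_iff_left inferInstance

/-- Cutting the new edge of `V ∪_v S`. -/
theorem α_graft_ne_zero {V S : Type} [PartialOrder V] [PartialOrder S] [Finite V] [Finite S]
    (hV : IsTreeOrder V) (hS : IsTreeOrder S) (v : V) :
    α (cls S) (cls (Graft V v S)) (cls V) ≠ 0 := by
  obtain ⟨b, hb⟩ := hS.1
  refine (α_ne_zero_iff (hV.graft hS v)).2 ⟨.inr b, ⟨not_isBot_inr b, ?_⟩, ?_⟩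
  · rw [cls_congr (subInrIso v _ (fun a => b ≤ a) (fun _ => Iff.rfl) fun _ h => h),
      cls_congr (subTopIso _ hb)]
  · exact cls_congr ((subInlIso v _ (fun _ => True) (fun a => iff_of_true (fun h => h) trivial)
      fun a h => h (hb a)).trans (subTopIso _ fun _ => trivial))

/-- The edge created by a grafting can be cut again. Thus the uniqueness statement
`eq_of_α_pathGraft` about cuts also covers graftings, and one lemma serves both signs of generators.
-/
theorem α_ne_zero_of_β_ne_zero {s t r : Tree} (h : β s t r ≠ 0) : α t s r ≠ 0 := by
  rw [← cls_rep t, ← cls_rep r] at h ⊢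
  obtain ⟨v, rfl⟩ := (β_ne_zero_iff r.rep.isTreeOrder t.rep.isTreeOrder).1 h
  exact α_graft_ne_zero r.rep.isTreeOrder t.rep.isTreeOrder v

theorem isTreeOrder_fin (n : ℕ) : IsTreeOrder (Fin (n + 1)) :=
  ⟨⟨0, fun a => Fin.zero_le a⟩, fun a b _ _ _ => le_total a b⟩

/-- The path with `n + 1` vertices. -/
noncomputable def path (n : ℕ) : Tree := cls (Fin (n + 1))

theorem order_path (n : ℕ) : (path n).order = n + 1 :=
  (order_cls (isTreeOrder_fin n)).trans (Nat.card_fin _)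

/-- The tree obtained by grafting `t` at the root of a path with `n + 1` vertices. -/
noncomputable def pathGraft (n : ℕ) (t : Tree) : Tree := cls (Graft (Fin (n + 1)) 0 t.rep)

theorem β_pathGraft (n : ℕ) (t : Tree) : β (pathGraft n t) t (path n) ≠ 0 := by
  conv in β _ t _ => rw [← cls_rep t]
  exact (β_ne_zero_iff (isTreeOrder_fin n) t.rep.isTreeOrder).2 ⟨0, by rw [cls_rep]; rfl⟩

theorem order_pathGraft (n : ℕ) (t : Tree) : (pathGraft n t).order = n + 1 + t.order := by
  rw [β_order (β_pathGraft n t), order_path]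

/-- Used to exclude cuts: if two incomparable vertices survive, the remaining tree is not a path. -/
theorem le_of_cls_path {V : Type} [PartialOrder V] [Finite V] (hV : IsTreeOrder V) {n : ℕ}
    (h : cls V = path n) (a b : V) : a ≤ b ∨ b ≤ a := by
  obtain ⟨f⟩ := (cls_eq_iff hV _).1 h
  obtain ⟨g⟩ := nonempty_rep_cls (isTreeOrder_fin n)
  exact (le_total (g.symm (f a)) (g.symm (f b))).imp
    (fun h => f.le_iff_le.1 (g.symm.le_iff_le.1 h)) fun h => f.le_iff_le.1 (g.symm.le_iff_le.1 h)

/-- The grafted tree is recovered from `pathGraft n t` by cutting off a small branch so that a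
path of the original length remains. -/
theorem eq_of_α_pathGraft {n : ℕ} {t u : Tree} (ht : t.order < n)
    (h : α u (pathGraft n t) (path n) ≠ 0) : u = t := by
  -- Counting vertices gives $|u|=|t|<n$.
  have hord := α_order h
  rw [order_pathGraft, order_path] at hord
  have hG := (isTreeOrder_fin n).graft t.rep.isTreeOrder 0
  obtain ⟨v, ⟨hv, h1⟩, h2⟩ := (α_ne_zero_iff hG).1 h
  have hT := hG.trunk hv
  rcases v with i | b
  · exfalso
    have hi : ¬ i ≤ 0 := fun hi => hv ((isBot_inl i).2 fun a => hi.trans (Fin.zero_le a))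
    -- A cut above vertex $1$ of the path leaves vertex $1$ and the root of $t$, which are
    -- incomparable.
    by_cases h1i : 1 < i.val
    · have hlt : (1 : ℕ) < n + 1 := by omega
      have hc := le_of_cls_path hT h2 ⟨.inl ⟨1, hlt⟩, fun hle => by
          have : i.val ≤ 1 := hle
          omega⟩ ⟨.inr ⊥, fun hle => hi hle⟩
      rcases hc with hc | hc
      · have : (1 : ℕ) ≤ 0 := hc
        omega
      · exact hc
    -- A cut just above the root of the path removes $n$ vertices, too many for $|u|<n$. This is
    -- where the length of the path matters.
    · have hi1 : i.val = 1 := by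
        have : i.val ≠ 0 := fun h0 => hi (le_of_eq (Fin.ext h0))
        omega
      have h3 : u.order = Nat.card {w : Fin (n + 1) // i ≤ w} := by
        rw [← h1, cls_congr (subInlIso 0 _ (fun a => i ≤ a) (fun _ => Iff.rfl) fun _ h => hi h),
          order_cls ((isTreeOrder_fin n).branch i)]
      have h4 : Nat.card (Fin n) ≤ Nat.card {w : Fin (n + 1) // i ≤ w} :=
        Nat.card_le_card_of_injective (fun k => ⟨k.succ, by
          rw [Fin.le_def, hi1, Fin.val_succ]; omega⟩)
          fun k l hkl => Fin.succ_injective _ (Subtype.ext_iff.1 hkl)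
      rw [Nat.card_fin] at h4
      omega
  · by_cases hb : b ≤ ⊥
    · rw [← h1, cls_congr (subInrIso _ _ (fun a => b ≤ a) (fun _ => Iff.rfl) fun _ h => h),
        cls_congr (subTopIso _ fun a => hb.trans bot_le), cls_rep]
    -- A cut strictly inside $t$ leaves the root of $t$ and the end of the path, which are
    -- incomparable since $n>0$.
    · exfalso
      have hc := le_of_cls_path hT h2 ⟨.inl (Fin.last n), fun h => h⟩ ⟨.inr ⊥, hb⟩
      rcases hc with hc | hc
      · have : n ≤ 0 := hc
        omega
      · exact hc

/-- Cutting an edge of `pathGraft n t` cannot leave a path of the original length as the branch. -/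
theorem α_path_pathGraft {n : ℕ} {t : Tree} (ht : t.order < n) (u : Tree) :
    α (path n) (pathGraft n t) u = 0 := by
  by_contra h
  have hG := (isTreeOrder_fin n).graft t.rep.isTreeOrder 0
  obtain ⟨v, ⟨hv, h1⟩, -⟩ := (α_ne_zero_iff hG).1 h
  have h2 := congrArg Tree.order h1
  rw [order_path] at h2
  -- A branch starting at a non-root vertex of the path has at most $n$ vertices, and a branch
  -- inside $t$ has at most $|t|<n$; neither has $n+1$.
  rcases v with i | b
  · have hi : ¬ i ≤ 0 := fun hi => hv ((isBot_inl i).2 fun a => hi.trans (Fin.zero_le a))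
    rw [cls_congr (subInlIso 0 _ (fun a => i ≤ a) (fun _ => Iff.rfl) fun _ h => hi h),
      order_cls ((isTreeOrder_fin n).branch i)] at h2
    have h3 := Fintype.card_subtype_lt (p := fun w : Fin (n + 1) => i ≤ w) (x := 0) hi
    rw [Nat.card_eq_fintype_card] at h2
    rw [h2, Fintype.card_fin] at h3
    omega
  · rw [cls_congr (subInrIso _ _ (fun a => b ≤ a) (fun _ => Iff.rfl) fun _ h => h),
      order_cls (t.rep.isTreeOrder.branch b)] at h2
    have h3 : Nat.card {w : t.rep // b ≤ w} ≤ t.order := Finite.card_subtype_le _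
    omega

/-! ### Coordinates of brackets -/

theorem repr_finsum_Dm (c : Tree → ℂ) (hc : (Function.support c).Finite) (q : Tree) :
    basis.repr (∑ᶠ r, c r • Dm r) (.minus q) = c q := by
  have := map_finsum (basis.coord (.minus q)) (f := fun r => c r • Dm r)
    (hc.subset (Function.support_smul_subset_left c _))
  simp only [Module.Basis.coord_apply] at this
  rw [this, finsum_eq_single _ q]
  · simp [Dm]
  · intro r hr
    have : (Gen.minus r) ≠ .minus q := fun h => hr (by injection h)
    simp [Dm, Finsupp.single_eq_of_ne this.symm]

theorem repr_finsum_Dp (c : Tree → ℂ) (hc : (Function.support c).Finite) (q : Tree) :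
    basis.repr (∑ᶠ r, c r • Dp r) (.minus q) = 0 := by
  have := map_finsum (basis.coord (.minus q)) (f := fun r => c r • Dp r)
    (hc.subset (Function.support_smul_subset_left c _))
  simp only [Module.Basis.coord_apply] at this
  rw [this]
  refine finsum_eq_zero_of_forall_eq_zero fun r => ?_
  simp [Dp]

open Classical in
theorem repr_lie_Dm_d (s q : Tree) :
    basis.repr ⁅Dm s, basis .d⁆ (.minus q) = if s = q then (s.order : ℂ) else 0 := by
  have : ⁅Dm s, basis .d⁆ = (s.order : ℂ) • Dm s := lie_basis _ _
  rw [this]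
  by_cases h : s = q
  · simp [Dm, h]
  · have h' : (Gen.minus s) ≠ .minus q := fun h' => h (by injection h')
    simp [Dm, h, Finsupp.single_eq_of_ne h'.symm]

theorem repr_lie_Dm_plus (s t q : Tree) :
    basis.repr ⁅Dm s, basis (.plus t)⁆ (.minus q) = β s t q := by
  classical
  have : ⁅Dm s, basis (.plus t)⁆ = crossBracket s t := lie_basis _ _
  rw [this, crossBracket, map_add, map_add, Finsupp.add_apply, Finsupp.add_apply,
    repr_finsum_Dp _ (finite_α_right s t), repr_finsum_Dm _ (finite_β_right s t)]
  split_ifs <;> simp [d]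

theorem repr_lie_Dm_minus (s t q : Tree) :
    basis.repr ⁅Dm s, basis (.minus t)⁆ (.minus q) = (α t q s : ℂ) - α s q t := by
  have : ⁅Dm s, basis (.minus t)⁆ = ∑ᶠ r, ((α t r s : ℂ) - α s r t) • Dm r := lie_basis _ _
  rw [this, repr_finsum_Dm _ (support_sub_finite (finite_α_mid t s) (finite_α_mid s t))]

/-! ### The center of the enveloping algebra -/

/-- The number of vertices of the tree that labels a basis element. -/
noncomputable def Gen.order : Gen → ℕ
  | .d => 0
  | .plus t => t.order
  | .minus t => t.order

theorem β_eq_zero {s t r : Tree} (h : s.order ≠ r.order + t.order) : β s t r = 0 := by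
  by_contra h'
  exact h (β_order h')

theorem α_eq_zero {s t r : Tree} (h : t.order ≠ s.order + r.order) : α s t r = 0 := by
  by_contra h'
  exact h (α_order h')

open Classical in
/-- Bracketing with the elements `D_s^-` for large `s` separates the basis elements of bounded
order. -/
theorem exists_separating_bracket (n : ℕ) (a : Gen) (ha : a.order < n) :
    ∃ (s q : Tree) (k : ℂ), k ≠ 0 ∧ n < q.order ∧ ∀ c : Gen, c.order < n →
      basis.repr ⁅Dm s, basis c⁆ (.minus q) = if a = c then k else 0 := by
  have hp := order_path n
  rcases a with _ | t | t
  -- With $s=q$ only $d$ preserves the number of vertices, and it contributes the factor $|s|=n+1$.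
  -- Here the path serves merely as a tree with more than $n$ vertices.
  · refine ⟨path n, path n, n + 1, by exact_mod_cast n.succ_ne_zero, by omega, ?_⟩
    rintro (_ | u | u) hu
    · rw [repr_lie_Dm_d, if_pos rfl, if_pos rfl, hp]
      push_cast
      rfl
    · have := u.order_pos
      rw [repr_lie_Dm_plus, β_eq_zero (by omega), if_neg (by simp), Nat.cast_zero]
    · have := u.order_pos
      rw [repr_lie_Dm_minus, α_eq_zero (by omega), α_eq_zero (by omega), if_neg (by simp),
        sub_self]
  · have hq := order_pathGraft n t
    have ht := t.order_pos
    -- The coefficient at $D_u^+$ counts the ways to graft $u$ on the path so as to obtain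
    -- `pathGraft n t`, which forces $u=t$. For $D_u^-$ the coefficient vanishes because $|s|>|q|$.
    refine ⟨pathGraft n t, path n, β (pathGraft n t) t (path n),
      Nat.cast_ne_zero.2 (β_pathGraft n t), by omega, ?_⟩
    rintro (_ | u | u) hu
    · have hne : pathGraft n t ≠ path n := fun h => by rw [h] at hq; omega
      rw [repr_lie_Dm_d, if_neg hne, if_neg (by simp)]
    · rw [repr_lie_Dm_plus]
      by_cases h : t = u
      · rw [if_pos (by rw [h]), h]
      · rw [if_neg fun h' => h (by injection h'), Nat.cast_eq_zero]
        by_contra h'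
        exact h (eq_of_α_pathGraft ha (α_ne_zero_of_β_ne_zero h')).symm
    · have := u.order_pos
      rw [repr_lie_Dm_minus, α_eq_zero (by omega), α_eq_zero (by omega), if_neg (by simp),
        sub_self]
  · have hq := order_pathGraft n t
    have ht := t.order_pos
    -- The roles of $s$ and $q$ are exchanged. The coefficient at $D_u^-$ has two terms: cuts that
    -- leave the path as trunk, which force $u=t$, and cuts that leave it as branch, which
    -- `α_path_pathGraft` excludes. For $D_u^+$ the coefficient vanishes because $|s|<|q|$.
    refine ⟨path n, pathGraft n t, α t (pathGraft n t) (path n),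
      Nat.cast_ne_zero.2 (α_ne_zero_of_β_ne_zero (β_pathGraft n t)), by omega, ?_⟩
    rintro (_ | u | u) hu
    · have hne : path n ≠ pathGraft n t := fun h => by rw [← h] at hq; omega
      rw [repr_lie_Dm_d, if_neg hne, if_neg (by simp)]
    · have := u.order_pos
      rw [repr_lie_Dm_plus, β_eq_zero (by omega), if_neg (by simp), Nat.cast_zero]
    · rw [repr_lie_Dm_minus, α_path_pathGraft ha, Nat.cast_zero, sub_zero]
      by_cases h : t = u
      · rw [if_pos (by rw [h]), h]
      · rw [if_neg fun h' => h (by injection h'), Nat.cast_eq_zero]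
        by_contra h'
        exact h (eq_of_α_pathGraft ha h').symm

/-- The action of `𝔤` on the space spanned by the trees, as a homomorphism of Lie algebras. -/
noncomputable def treeRep : Alg →ₗ⁅ℂ⁆ Module.End ℂ TreeSpace :=
  { ρ with
    map_lie' := fun {x y} => LinearMap.ext fun v => ρ_bracket x y v }

theorem center_enveloping_eq_bot :
    Subalgebra.center ℂ (UniversalEnvelopingAlgebra ℂ Alg) = ⊥ := by
  classical
  refine EnvelopingCenter.center_eq_bot treeRep ρ_injective basis fun S a ha => ?_
  have hb : ∀ c ∈ S, c.order < S.sup Gen.order + 1 := fun c hc =>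
    Nat.lt_succ_of_le (Finset.le_sup (f := Gen.order) hc)
  obtain ⟨s, q, k, hk, hq, h⟩ := exists_separating_bracket _ a (hb a ha)
  -- The functional vanishes on $S$ because $q$ has more vertices than any label in $S$; the factor
  -- $k^{-1}$ normalizes the detected coefficient to $1$.
  refine ⟨Dm s, k⁻¹ • basis.coord (.minus q), fun c hc => ?_, fun c hc => ?_⟩
  · have hne : c ≠ .minus q := fun h' => by
      have := hb c hc
      rw [h'] at this
      exact absurd (hq.trans this) (lt_irrefl _)
    rw [LinearMap.smul_apply, Module.Basis.coord_apply, Module.Basis.repr_self,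
      Finsupp.single_eq_of_ne hne.symm, smul_zero]
  · rw [LinearMap.smul_apply, Module.Basis.coord_apply, h c (hb c hc)]
    split_ifs
    · exact inv_mul_cancel₀ hk
    · exact smul_zero _

end InsElim

/-- Every Verma module for the insertion-elimination Lie algebra admits the same central
character. -/
theorem mainTheorem3 :
    ∃ χ : Subalgebra.center ℂ (UniversalEnvelopingAlgebra ℂ InsElim.Alg) →ₐ[ℂ] ℂ,
      ∀ μ : Module.Dual ℂ InsElim.𝔥,
        InsElim.AdmitsCentralCharacter (InsElim.Verma μ) χ := by
  let : LieRing ℂ := LieRing.ofAssociativeRing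
  -- The augmentation, which extends the zero character of $\mathfrak{g}$; on the scalars, hence on
  -- the center, it is the identity.
  let ε : UniversalEnvelopingAlgebra ℂ InsElim.Alg →ₐ[ℂ] ℂ := UniversalEnvelopingAlgebra.lift ℂ 0
  refine ⟨ε.comp (Subalgebra.val _), fun μ z v => ?_⟩
  obtain ⟨c, hc⟩ := Algebra.mem_bot.1 (InsElim.center_enveloping_eq_bot.le z.2)
  change z.1 • v = ε z.1 • v
  rw [← hc, AlgHom.commutes, algebraMap_smul]
  rfl
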